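/- Call a Borel probability measure $\mu$ on $[0,1]^2$ coherent with mean $p$, and write $\mu\in\mathcal C_p$, if there are a probability space $(\Omega,\mathcal F,\mathbb P)$, a $\{0,1\}$-valued random variable $X$ on it with $\mathbb E[X]=p$, and sub-sigma-algebras $\mathcal F_1,\mathcal F_2\subseteq\mathcal F$ such that $\mu$ is the joint law of $(\mathbb E[X\mid\mathcal F_1],\mathbb E[X\mid\mathcal F_2])$. For $\alpha>0$ let $$V(\alpha)=2\left(\frac{3\alpha+1-\sqrt{\alpha^2+6\alpha+1}}{2\alpha}\right)^{\alpha}\cdot\frac{-(\alpha+1)+\sqrt{\alpha^2+6\alpha+1}}{\alpha-1+\sqrt{\alpha^2+6\alpha+1}}.$$ Then there is exactly one $\alpha_0>0$ with $V(\alpha_0)=2^{-\alpha_0}$; it satisfies $|\alpha_0-2.25751|<5\cdot10^{-6}$; and for every $\alpha>0$ the maximum below is attained and $$\max_{\mu\in\mathcal C_{1/2}}\int|x_1-x_2|^\alpha\,d\mu(x_1,x_2)=\begin{cases}2^{-\alpha}&\text{if }\alpha<\alpha_0,\\ V(\alpha)&\text{if }\alpha\ge\alpha_0.\end{cases}$$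 Moreover, for $\alpha\ge\alpha_0$, put $a=\frac{-(\alpha+1)+\sqrt{\alpha^2+6\alpha+1}}{2\alpha}$. Then $0<a<\tfrac12$, and the maximum is attained at the six-point distribution that gives mass $\frac{a}{2(a+1)}$ to each of the points $(a,1),(1,a),(0,1-a),(1-a,0)$ and mass $\frac{1-a}{2(a+1)}$ to each of the points $(a,a),(1-a,1-a)$. -/

import Mathlib

open MeasureTheory

universe u

/-- `IsCoherent p μ`: the law `μ` on the plane is concentrated on the unit square and is the joint
law of `(E[X | F₁], E[X | F₂])`, where `X` is a Bernoulli random variable with mean `p` on some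
probability space `(Ω, mΩ, P)` and `F₁`, `F₂` are sub-sigma-algebras of `mΩ`. -/
def IsCoherent (p : ℝ) (μ : Measure (ℝ × ℝ)) : Prop :=
  μ (Set.Icc (0 : ℝ) 1 ×ˢ Set.Icc (0 : ℝ) 1)ᶜ = 0 ∧
  ∃ (Ω : Type u) (F₁ F₂ mΩ : MeasurableSpace Ω) (P : Measure Ω) (X : Ω → ℝ),
    IsProbabilityMeasure P ∧ F₁ ≤ mΩ ∧ F₂ ≤ mΩ ∧
    Measurable X ∧ (∀ᵐ ω ∂P, X ω = 0 ∨ X ω = 1) ∧ ∫ ω, X ω ∂P = p ∧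
    μ = P.map (fun ω => ((P[X | F₁]) ω, (P[X | F₂]) ω))

/-- The expectation `E |X₁ - X₂| ^ α` when `(X₁, X₂)` has law `μ`. -/
noncomputable def absDiffMoment (α : ℝ) (μ : Measure (ℝ × ℝ)) : ℝ :=
  ∫ x, |x.1 - x.2| ^ α ∂μ

/-- The value of the maximum in the second regime. -/
noncomputable def largeValue (α : ℝ) : ℝ :=
  2 * ((3 * α + 1 - √(α ^ 2 + 6 * α + 1)) / (2 * α)) ^ α *
    ((-(α + 1) + √(α ^ 2 + 6 * α + 1)) / (α - 1 + √(α ^ 2 + 6 * α + 1)))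

/-- The parameter of the six-point distribution that is optimal in the second regime. -/
noncomputable def sixPointParam (α : ℝ) : ℝ :=
  (-(α + 1) + √(α ^ 2 + 6 * α + 1)) / (2 * α)

/-- The six-point law with mass `a / (2(a+1))` at each of `(a, 1)`, `(1, a)`, `(0, 1-a)`,
`(1-a, 0)` and mass `(1-a) / (2(a+1))` at each of `(1-a, 1-a)`, `(a, a)`; used for `0 < a < 1/2`. -/
noncomputable def sixPoint (a : ℝ) : Measure (ℝ × ℝ) :=
  ENNReal.ofReal (a / (2 * (a + 1))) •
      (Measure.dirac (a, 1) + Measure.dirac (1, a) +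
        Measure.dirac (0, 1 - a) + Measure.dirac (1 - a, 0)) +
    ENNReal.ofReal ((1 - a) / (2 * (a + 1))) •
      (Measure.dirac (1 - a, 1 - a) + Measure.dirac (a, a))

/-!
The upper bounds are weak linear-programming duality. For a coherent pair `Y₁, Y₂` of conditional
expectations of `X` and a bounded Borel function `f`, the variables `(X - Yᵢ) f(Yᵢ)` have mean
zero. If therefore `|x - y| ^ α ≤ V + (1 - x) f(x) + (1 - y) f(y)` and
`|x - y| ^ α ≤ V - x f(x) - y f(y)` on the unit square, then `E |Y₁ - Y₂| ^ α ≤ V`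
(`IsCoherent.absDiffMoment_le`). The symmetry `x ↦ 1 - x` suggests an odd certificate, determined
by its restriction `g` to `[0, 1/2]`. Complementary slackness at the six-point law forces the value
`(1 - a) ^ α = V + (1 - a) g(a)`, and the certificate used is
`g(x) = (max (T, (1 - x) ^ α) - V) / (1 - x)` with a threshold `T = t ^ α` (`thresholdCert`).
By `IsCoherent.absDiffMoment_le_of_threshold` its validity reduces to the single inequality
`(y - x) ^ α ≤ V - x g(x) - y g(y)` for `0 ≤ x ≤ y ≤ 1/2`.

The six-point law with parameter `z` has moment `2 z / (1 + z) * (1 - z) ^ α`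
(`sixPointValue`). Its maximiser over `z` in `(0, 1)` is the `a` of the statement, characterised by
`α a (1 + a) = 1 - a` (`IsOptimalParam`); the maximum is `largeValue α`. The remaining inequality is
proved in two ranges.

* For `9/4 ≤ α ≤ 4` take `T = V`. When the threshold is inactive at both points the inequality
  compares `V (1 - x y)` with an average of `(1 - x) ^ α`, `(1 - y) ^ α` and `(y - x) ^ α`. As `V` is
  at least the value of the six-point law with parameter `(x + y) / 2`, one may divide by
  `(1 - (x + y) / 2) ^ α`; the result is convex in `α`, so that it is enough to have it at a few
  exponents, where it follows from polynomial inequalities (`three_point_le_sixPointValue`). For `x`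
  near `0` and `α` near the critical exponent, the bound `V ≥ 2 ^ (-α)` is used in the same way.
* For `α ≥ 4` take `T = 1.36 V`. In the variable `r = (a - x) / (a (1 + a))` one has
  `(1 - x) ^ α ≤ (1 - a) ^ α exp r`, so that the certificate leaves at `x` a margin of at least
  `a (1 - a) ^ α (1 - (1 - r) exp r)`, quadratic in `r` near `0`. It dominates `(y - x) ^ α` if both
  points are near `a`, and otherwise the margin at the larger point is a fixed fraction of `V`.

The quotient of the six-point value by `2 ^ (-α)` increases strictly from the moment it reaches `1`
(`IsOptimalParam.half_rpow_lt`), which gives the uniqueness of the critical exponent `α₀`; the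
intermediate value theorem locates it. Below `α₀` the bound `2 ^ (-α₀)` at `α₀` passes down by a
pointwise Bernoulli inequality (`IsCoherent.absDiffMoment_le_half_rpow_of_le`).
-/

/-! ### Weak duality for coherent laws -/

/-- If `Y = E[X | F]` then `E[(X - Y) f(Y)] = 0` for every bounded Borel function `f`. -/
theorem integral_sub_condExp_mul_comp {Ω : Type u} {F mΩ : MeasurableSpace Ω} {P : Measure Ω}
    [IsProbabilityMeasure P] (hF : F ≤ mΩ) {X : Ω → ℝ} (hX : Integrable X P) {f : ℝ → ℝ}
    (hf : Measurable f) {C : ℝ} (hC : ∀ᵐ ω ∂P, |f ((P[X | F]) ω)| ≤ C) :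
    Integrable (fun ω => (X ω - (P[X | F]) ω) * f ((P[X | F]) ω)) P ∧
      ∫ ω, (X ω - (P[X | F]) ω) * f ((P[X | F]) ω) ∂P = 0 := by
  set Y := P[X | F] with hY
  have hYm : StronglyMeasurable[F] Y := stronglyMeasurable_condExp
  have hfY : StronglyMeasurable[F] (fun ω => f (Y ω)) :=
    (hf.comp hYm.measurable).stronglyMeasurable
  have hfY' : AEStronglyMeasurable (fun ω => f (Y ω)) P := (hfY.mono hF).aestronglyMeasurable
  have hYi : Integrable Y P := integrable_condExp
  have i1 : Integrable (fun ω => f (Y ω) * X ω) P := hX.bdd_mul hfY' hC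
  have i2 : Integrable (fun ω => f (Y ω) * Y ω) P := hYi.bdd_mul hfY' hC
  have key : ∫ ω, f (Y ω) * X ω ∂P = ∫ ω, f (Y ω) * Y ω ∂P := by
    have h := condExp_stronglyMeasurable_mul_of_bound hF hfY hX C hC
    calc ∫ ω, f (Y ω) * X ω ∂P = ∫ ω, (P[(fun ω => f (Y ω)) * X | F]) ω ∂P :=
          (integral_condExp hF).symm
      _ = ∫ ω, f (Y ω) * Y ω ∂P := integral_congr_ae h
  have e : (fun ω => (X ω - Y ω) * f (Y ω)) = fun ω => f (Y ω) * X ω - f (Y ω) * Y ω := by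
    funext ω; ring
  rw [e]
  exact ⟨i1.sub i2, by rw [integral_sub i1 i2, key, sub_self]⟩

/-- A dual certificate `f` bounds the moment: on `{X = 1}` the first inequality is used and on
`{X = 0}` the second one, and the two terms `(X - Yᵢ) f(Yᵢ)` have mean zero. -/
theorem IsCoherent.absDiffMoment_le {p : ℝ} {μ : Measure (ℝ × ℝ)} (hμ : IsCoherent.{u} p μ)
    {α V C : ℝ} (hα : 0 < α) {f : ℝ → ℝ} (hf : Measurable f)
    (hC : ∀ x ∈ Set.Icc (0 : ℝ) 1, |f x| ≤ C)
    (h1 : ∀ x ∈ Set.Icc (0 : ℝ) 1, ∀ y ∈ Set.Icc (0 : ℝ) 1,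
      |x - y| ^ α ≤ V + (1 - x) * f x + (1 - y) * f y)
    (h0 : ∀ x ∈ Set.Icc (0 : ℝ) 1, ∀ y ∈ Set.Icc (0 : ℝ) 1,
      |x - y| ^ α ≤ V - x * f x - y * f y) :
    absDiffMoment α μ ≤ V := by
  obtain ⟨hs, Ω, F₁, F₂, mΩ, P, X, hP, hF₁, hF₂, hX, hX01, -, rfl⟩ := hμ
  have hm₁ : Measurable (P[X | F₁]) := (stronglyMeasurable_condExp.mono hF₁).measurable
  have hm₂ : Measurable (P[X | F₂]) := (stronglyMeasurable_condExp.mono hF₂).measurable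
  have hm : Measurable (fun ω => ((P[X | F₁]) ω, (P[X | F₂]) ω)) := hm₁.prodMk hm₂
  have hXi : Integrable X P := by
    refine Integrable.of_bound hX.aestronglyMeasurable 1 ?_
    filter_upwards [hX01] with ω h
    rcases h with h | h <;> simp [h]
  have hsq : ∀ᵐ ω ∂P, (P[X | F₁]) ω ∈ Set.Icc (0 : ℝ) 1 ∧ (P[X | F₂]) ω ∈ Set.Icc (0 : ℝ) 1 := by
    have h : ∀ᵐ z ∂(P.map fun ω => ((P[X | F₁]) ω, (P[X | F₂]) ω)),
        z ∈ Set.Icc (0 : ℝ) 1 ×ˢ Set.Icc (0 : ℝ) 1 := hs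
    exact ae_of_ae_map hm.aemeasurable h
  obtain ⟨i₁, e₁⟩ := integral_sub_condExp_mul_comp hF₁ hXi hf (C := C)
    (hsq.mono fun ω h => hC _ h.1)
  obtain ⟨i₂, e₂⟩ := integral_sub_condExp_mul_comp hF₂ hXi hf (C := C)
    (hsq.mono fun ω h => hC _ h.2)
  have hcont : Continuous fun x : ℝ × ℝ => |x.1 - x.2| ^ α :=
    (continuous_fst.sub continuous_snd).abs.rpow_const fun _ => Or.inr hα.le
  unfold absDiffMoment
  rw [integral_map hm.aemeasurable hcont.aestronglyMeasurable]
  set Y := P[X | F₁]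
  set Z := P[X | F₂]
  have hle : ∀ᵐ ω ∂P, |Y ω - Z ω| ^ α ≤
      V + (X ω - Y ω) * f (Y ω) + (X ω - Z ω) * f (Z ω) := by
    filter_upwards [hsq, hX01] with ω hω hXω
    rcases hXω with h | h
    · have := h0 _ hω.1 _ hω.2
      rw [h]; linarith
    · have := h1 _ hω.1 _ hω.2
      rw [h]; linarith
  have hint : Integrable (fun ω => |Y ω - Z ω| ^ α) P := by
    refine Integrable.of_bound (hcont.measurable.comp hm).aestronglyMeasurable 1 ?_
    filter_upwards [hsq] with ω hω
    have h : |Y ω - Z ω| ≤ 1 := by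
      rw [abs_le]; constructor <;> linarith [hω.1.1, hω.1.2, hω.2.1, hω.2.2]
    change ‖|Y ω - Z ω| ^ α‖ ≤ 1
    rw [Real.norm_of_nonneg (by positivity)]
    exact Real.rpow_le_one (abs_nonneg _) h hα.le
  calc ∫ ω, |Y ω - Z ω| ^ α ∂P
      ≤ ∫ ω, V + (X ω - Y ω) * f (Y ω) + (X ω - Z ω) * f (Z ω) ∂P :=
        integral_mono_ae hint (((integrable_const V).add i₁).add i₂) hle
    _ = V := by
        have i₀ : Integrable (fun ω => V + (X ω - Y ω) * f (Y ω)) P := (integrable_const V).add i₁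
        rw [integral_add i₀ i₂, integral_add (integrable_const V) i₁, e₁, e₂]
        simp

/-- Weak duality for a certificate that is odd under `x ↦ 1 - x`; only its values `g` on
`[0, 1/2]` are needed. -/
theorem IsCoherent.absDiffMoment_le_of_half {p : ℝ} {μ : Measure (ℝ × ℝ)}
    (hμ : IsCoherent.{u} p μ) {α V C : ℝ} (hα : 0 < α) {g : ℝ → ℝ} (hg : Measurable g)
    (hC : ∀ x ∈ Set.Icc (0 : ℝ) (1 / 2), |g x| ≤ C)
    (h1 : ∀ x ∈ Set.Icc (0 : ℝ) (1 / 2), ∀ y ∈ Set.Icc (0 : ℝ) (1 / 2),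
      |x - y| ^ α ≤ V + (1 - x) * g x + (1 - y) * g y)
    (h0 : ∀ x ∈ Set.Icc (0 : ℝ) (1 / 2), ∀ y ∈ Set.Icc (0 : ℝ) (1 / 2),
      |x - y| ^ α ≤ V - x * g x - y * g y)
    (h2 : ∀ x ∈ Set.Icc (0 : ℝ) (1 / 2), ∀ y ∈ Set.Icc (0 : ℝ) (1 / 2),
      (1 - x - y) ^ α ≤ V + (1 - x) * g x - y * g y) :
    absDiffMoment α μ ≤ V := by
  classical
  set f : ℝ → ℝ := fun x => if x ≤ 1 / 2 then g x else -g (1 - x) with hf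
  have f1 : ∀ {x : ℝ}, x ≤ 1 / 2 → f x = g x := fun h => if_pos h
  have f2 : ∀ {x : ℝ}, ¬ x ≤ 1 / 2 → f x = -g (1 - x) := fun h => if_neg h
  have mem1 : ∀ {x : ℝ}, x ∈ Set.Icc (0 : ℝ) 1 → x ≤ 1 / 2 → x ∈ Set.Icc (0 : ℝ) (1 / 2) :=
    fun hx h => ⟨hx.1, h⟩
  have mem2 : ∀ {x : ℝ}, x ∈ Set.Icc (0 : ℝ) 1 → ¬ x ≤ 1 / 2 →
      1 - x ∈ Set.Icc (0 : ℝ) (1 / 2) :=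
    fun hx h => ⟨by linarith [hx.2], by linarith⟩
  refine hμ.absDiffMoment_le (f := f) (C := C) hα ?_ ?_ ?_ ?_
  · exact Measurable.ite measurableSet_Iic hg (hg.comp (measurable_const.sub measurable_id)).neg
  · intro x hx
    by_cases h : x ≤ 1 / 2
    · rw [f1 h]; exact hC _ (mem1 hx h)
    · rw [f2 h, abs_neg]; exact hC _ (mem2 hx h)
  · intro x hx y hy
    by_cases h : x ≤ 1 / 2 <;> by_cases h' : y ≤ 1 / 2
    · rw [f1 h, f1 h']; exact h1 _ (mem1 hx h) _ (mem1 hy h')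
    · have := h2 _ (mem1 hx h) _ (mem2 hy h')
      rw [f1 h, f2 h', abs_sub_comm, abs_of_nonneg (by linarith)]
      rw [show 1 - x - (1 - y) = y - x by ring] at this
      linarith
    · have := h2 _ (mem1 hy h') _ (mem2 hx h)
      rw [f1 h', f2 h, abs_of_nonneg (by linarith)]
      rw [show 1 - y - (1 - x) = x - y by ring] at this
      linarith
    · have := h0 _ (mem2 hx h) _ (mem2 hy h')
      rw [show 1 - x - (1 - y) = -(x - y) by ring, abs_neg] at this
      rw [f2 h, f2 h']
      linarith
  · intro x hx y hy
    by_cases h : x ≤ 1 / 2 <;> by_cases h' : y ≤ 1 / 2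
    · rw [f1 h, f1 h']; exact h0 _ (mem1 hx h) _ (mem1 hy h')
    · have := h2 _ (mem2 hy h') _ (mem1 hx h)
      rw [f1 h, f2 h', abs_sub_comm, abs_of_nonneg (by linarith)]
      rw [show 1 - (1 - y) - x = y - x by ring] at this
      linarith
    · have := h2 _ (mem2 hx h) _ (mem1 hy h')
      rw [f1 h', f2 h, abs_of_nonneg (by linarith)]
      rw [show 1 - (1 - x) - y = x - y by ring] at this
      linarith
    · have := h1 _ (mem2 hx h) _ (mem2 hy h')
      rw [show 1 - x - (1 - y) = -(x - y) by ring, abs_neg] at this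
      rw [f2 h, f2 h']
      linarith

/-! ### Finitely supported coherent laws -/

/-- On a finite probability space with weights `w`, a function `A` with
`∑ wᵢ φ(Aᵢ) (Xᵢ - Aᵢ) = 0` for all `φ` is a version of the conditional expectation of `X` given
the sigma-algebra generated by `A`. -/
theorem condExp_comap_ae_eq_of_sum_dirac {ι : Type u} [Fintype ι] [mι : MeasurableSpace ι]
    [DiscreteMeasurableSpace ι] (w X A : ι → ℝ) (hw : ∀ i, 0 ≤ w i)
    (hA : ∀ φ : ℝ → ℝ, ∑ i, w i * φ (A i) * (X i - A i) = 0) :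
    A =ᵐ[∑ i, ENNReal.ofReal (w i) • Measure.dirac i]
      (∑ i, ENNReal.ofReal (w i) • Measure.dirac i)[X | MeasurableSpace.comap A inferInstance] := by
  classical
  set P : Measure ι := ∑ i, ENNReal.ofReal (w i) • Measure.dirac i with hPdef
  have : IsFiniteMeasure P := by
    refine ⟨?_⟩
    simp only [hPdef, Measure.coe_finsetSum, Finset.sum_apply, Measure.smul_apply, smul_eq_mul]
    refine ENNReal.sum_lt_top.2 fun i _ => ?_
    simp
  have hint : ∀ f : ι → ℝ, Integrable f P := fun f => Integrable.of_finite
  have hsum : ∀ f : ι → ℝ, ∫ i, f i ∂P = ∑ i, w i * f i := by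
    intro f
    rw [hPdef, integral_finsetSum_measure fun i _ =>
      (integrable_dirac (by simp)).smul_measure ENNReal.ofReal_ne_top]
    refine Finset.sum_congr rfl fun i _ => ?_
    rw [integral_smul_measure, integral_dirac, ENNReal.toReal_ofReal (hw i), smul_eq_mul]
  have hle : MeasurableSpace.comap A inferInstance ≤ mι := by
    rintro s ⟨t, -, rfl⟩
    exact MeasurableSet.of_discrete
  refine ae_eq_condExp_of_forall_setIntegral_eq hle (hint _) (fun s _ _ => (hint _).integrableOn)
    ?_ ?_
  · rintro s hs -
    have hs' := hs
    obtain ⟨t, -, rfl⟩ := hs'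
    rw [← integral_indicator (hle _ hs), ← integral_indicator (hle _ hs), hsum, hsum,
      ← sub_eq_zero, ← neg_eq_zero, ← hA (t.indicator 1), ← Finset.sum_sub_distrib,
      ← Finset.sum_neg_distrib]
    refine Finset.sum_congr rfl fun i _ => ?_
    by_cases h : A i ∈ t
    · simp only [Set.indicator, Set.mem_preimage, h, if_true, Pi.one_apply]; ring
    · simp [Set.indicator, h]
  · exact (comap_measurable A).aestronglyMeasurable

theorem isCoherent_sum_dirac {n : ℕ} {p : ℝ} (w X A B : Fin n → ℝ) (hw : ∀ i, 0 ≤ w i)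
    (hw1 : ∑ i, w i = 1) (hX : ∀ i, X i = 0 ∨ X i = 1) (hp : ∑ i, w i * X i = p)
    (hAI : ∀ i, A i ∈ Set.Icc (0 : ℝ) 1) (hBI : ∀ i, B i ∈ Set.Icc (0 : ℝ) 1)
    (hA : ∀ φ : ℝ → ℝ, ∑ i, w i * φ (A i) * (X i - A i) = 0)
    (hB : ∀ φ : ℝ → ℝ, ∑ i, w i * φ (B i) * (X i - B i) = 0) :
    IsCoherent.{u} p (∑ i, ENNReal.ofReal (w i) • Measure.dirac (A i, B i)) := by
  classical
  refine ⟨?_, ?_⟩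
  · simp only [Measure.coe_finsetSum, Finset.sum_apply, Measure.smul_apply, smul_eq_mul]
    refine Finset.sum_eq_zero fun i _ => ?_
    rw [Measure.dirac_apply' _ (measurableSet_Icc.prod measurableSet_Icc).compl]
    have : (A i, B i) ∈ Set.Icc (0 : ℝ) 1 ×ˢ Set.Icc (0 : ℝ) 1 := ⟨hAI i, hBI i⟩
    rw [Set.indicator_of_notMem (Set.notMem_compl_iff.2 this), mul_zero]
  · let ι := ULift.{u} (Fin n)
    let mι : MeasurableSpace ι := ⊤
    have : DiscreteMeasurableSpace ι := ⟨fun _ => trivial⟩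
    let P : Measure ι := ∑ i : ι, ENNReal.ofReal (w i.down) • Measure.dirac i
    have hsum : ∀ f : ι → ℝ, ∫ i, f i ∂P = ∑ i : ι, w i.down * f i := by
      intro f
      rw [integral_finsetSum_measure fun i _ =>
      (integrable_dirac (by simp)).smul_measure ENNReal.ofReal_ne_top]
      refine Finset.sum_congr rfl fun i _ => ?_
      rw [integral_smul_measure, integral_dirac, ENNReal.toReal_ofReal (hw i.down), smul_eq_mul]
    have hdown : ∀ {M : Type} [AddCommMonoid M] (f : Fin n → M),
        ∑ i : ι, f i.down = ∑ i, f i := fun f => Equiv.ulift.sum_comp f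
    have cA := condExp_comap_ae_eq_of_sum_dirac (ι := ι) (fun i => w i.down) (fun i => X i.down)
      (fun i => A i.down) (fun i => hw i.down)
      (fun φ => by rw [hdown fun i => w i * φ (A i) * (X i - A i)]; exact hA φ)
    have cB := condExp_comap_ae_eq_of_sum_dirac (ι := ι) (fun i => w i.down) (fun i => X i.down)
      (fun i => B i.down) (fun i => hw i.down)
      (fun φ => by rw [hdown fun i => w i * φ (B i) * (X i - B i)]; exact hB φ)
    refine ⟨ι, MeasurableSpace.comap (fun i => A i.down) inferInstance,
      MeasurableSpace.comap (fun i => B i.down) inferInstance, mι, P, fun i => X i.down,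
      ⟨?_⟩, le_top, le_top, measurable_from_top, Filter.Eventually.of_forall fun i => hX i.down,
      ?_, ?_⟩
    · simp only [P, Measure.coe_finsetSum, Finset.sum_apply, Measure.smul_apply, smul_eq_mul,
        measure_univ, mul_one]
      rw [hdown fun i => ENNReal.ofReal (w i), ← ENNReal.ofReal_sum_of_nonneg fun i _ => hw i, hw1,
        ENNReal.ofReal_one]
    · rw [hsum, hdown fun i => w i * X i, hp]
    · have hae : (fun i : ι => (A i.down, B i.down)) =ᵐ[P] fun i =>
          ((P[fun i : ι => X i.down | MeasurableSpace.comap (fun i : ι => A i.down) inferInstance]) i,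
            (P[fun i : ι => X i.down |
              MeasurableSpace.comap (fun i : ι => B i.down) inferInstance]) i) := by
        filter_upwards [cA, cB] with i h h'
        exact Prod.ext h h'
      rw [← Measure.map_congr hae, Measure.map_finset_sum (measurable_of_finite _).aemeasurable]
      rw [← hdown fun i => ENNReal.ofReal (w i) • Measure.dirac (A i, B i)]
      refine Finset.sum_congr rfl fun i _ => ?_
      rw [Measure.map_smul, Measure.map_dirac' (measurable_of_finite _)]

theorem absDiffMoment_sum_dirac {n : ℕ} (α : ℝ) (w A B : Fin n → ℝ) (hw : ∀ i, 0 ≤ w i) :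
    absDiffMoment α (∑ i, ENNReal.ofReal (w i) • Measure.dirac (A i, B i)) =
      ∑ i, w i * |A i - B i| ^ α := by
  unfold absDiffMoment
  rw [integral_finsetSum_measure fun i _ =>
    (integrable_dirac (by simp)).smul_measure ENNReal.ofReal_ne_top]
  refine Finset.sum_congr rfl fun i _ => ?_
  rw [integral_smul_measure, integral_dirac, ENNReal.toReal_ofReal (hw i), smul_eq_mul]

/-- Revealing `X` completely to one agent and nothing to the other gives the moment `2 ^ (-α)`. -/
theorem exists_isCoherent_absDiffMoment_eq_two_rpow_neg (α : ℝ) :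
    ∃ μ, IsCoherent.{u} (1 / 2) μ ∧ absDiffMoment α μ = (2 : ℝ) ^ (-α) := by
  refine ⟨_, isCoherent_sum_dirac (n := 2) ![1 / 2, 1 / 2] ![0, 1] ![1 / 2, 1 / 2] ![0, 1] ?_ ?_ ?_
    ?_ ?_ ?_ ?_ ?_, ?_⟩
  · intro i; fin_cases i <;> norm_num
  · norm_num
  · intro i; fin_cases i <;> simp
  · simp [Fin.sum_univ_two]
  · intro i; fin_cases i <;> norm_num
  · intro i; fin_cases i <;> norm_num
  · intro φ; simp [Fin.sum_univ_two]; ring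
  · intro φ; simp
  · rw [absDiffMoment_sum_dirac _ _ _ _ (by intro i; fin_cases i <;> norm_num)]
    simp only [Fin.sum_univ_two, Matrix.cons_val_zero, Matrix.cons_val_one]
    rw [show |(1 / 2 : ℝ) - 0| = 2⁻¹ by norm_num [abs_of_pos],
      show |(1 / 2 : ℝ) - 1| = 2⁻¹ by norm_num [abs_of_neg], Real.inv_rpow (by norm_num),
      Real.rpow_neg (by norm_num)]
    ring

theorem sixPoint_eq_sum_dirac (a : ℝ) :
    sixPoint a = ∑ i : Fin 6, ENNReal.ofReal
      ((![a / (2 * (a + 1)), a / (2 * (a + 1)), a / (2 * (a + 1)), a / (2 * (a + 1)),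
        (1 - a) / (2 * (a + 1)), (1 - a) / (2 * (a + 1))] : Fin 6 → ℝ) i) •
      Measure.dirac ((![a, 1, 0, 1 - a, 1 - a, a] : Fin 6 → ℝ) i,
        (![1, a, 1 - a, 0, 1 - a, a] : Fin 6 → ℝ) i) := by
  simp [Fin.sum_univ_six, sixPoint, smul_add, add_assoc]

theorem isCoherent_sixPoint {a : ℝ} (h0 : 0 < a) (h1 : a < 1 / 2) :
    IsCoherent.{u} (1 / 2) (sixPoint a) := by
  have ha : a + 1 ≠ 0 := by positivity
  have hp : 0 < 2 * (a + 1) := by positivity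
  have hw1 : 0 ≤ a / (2 * (a + 1)) := by positivity
  have hw2 : 0 ≤ (1 - a) / (2 * (a + 1)) := div_nonneg (by linarith) hp.le
  rw [sixPoint_eq_sum_dirac]
  refine isCoherent_sum_dirac _ ![1, 1, 0, 0, 1, 0] _ _ ?_ ?_ ?_ ?_ ?_ ?_ ?_ ?_
  · intro i; fin_cases i <;> assumption
  · simp [Fin.sum_univ_six]; field_simp; ring
  · intro i; fin_cases i <;> simp
  · simp [Fin.sum_univ_six]; field_simp; ring
  · intro i; fin_cases i <;> constructor <;> norm_num <;> linarith
  · intro i; fin_cases i <;> constructor <;> norm_num <;> linarith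
  · intro φ; simp [Fin.sum_univ_six]; field_simp; ring
  · intro φ; simp [Fin.sum_univ_six]; field_simp; ring

theorem absDiffMoment_sixPoint {α a : ℝ} (hα : 0 < α) (h0 : 0 < a) (h1 : a < 1 / 2) :
    absDiffMoment α (sixPoint a) = 2 * a / (1 + a) * (1 - a) ^ α := by
  have hp : 0 < 2 * (a + 1) := by positivity
  have hw1 : 0 ≤ a / (2 * (a + 1)) := by positivity
  have hw2 : 0 ≤ (1 - a) / (2 * (a + 1)) := div_nonneg (by linarith) hp.le
  rw [sixPoint_eq_sum_dirac, absDiffMoment_sum_dirac _ _ _ _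
    (by intro i; fin_cases i <;> assumption)]
  have e1 : |a - 1| = 1 - a := by rw [abs_sub_comm, abs_of_pos (by linarith)]
  have e2 : |1 - a| = 1 - a := abs_of_pos (by linarith)
  simp [Fin.sum_univ_six, e1, e2, Real.zero_rpow hα.ne']
  field_simp
  ring

/-! ### The value of the six-point laws and its maximiser -/

/-- The moment `E |X₁ - X₂| ^ α` of the six-point law with parameter `z`. -/
noncomputable def sixPointValue (α z : ℝ) : ℝ := 2 * z / (1 + z) * (1 - z) ^ α

/-- `a` is the critical point in `(0, 1)` of `z ↦ sixPointValue α z`. -/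
structure IsOptimalParam (α a : ℝ) : Prop where
  pos : 0 < a
  lt_one : a < 1
  eq : α * (a * (1 + a)) = 1 - a

theorem sixPointParam_isOptimalParam {α : ℝ} (hα : 0 < α) :
    IsOptimalParam α (sixPointParam α) := by
  unfold sixPointParam
  set s := √(α ^ 2 + 6 * α + 1) with hs
  have hs2 : s ^ 2 = α ^ 2 + 6 * α + 1 := Real.sq_sqrt (by positivity)
  have hs0 : 0 ≤ s := Real.sqrt_nonneg _
  have h1 : α + 1 < s := by nlinarith
  have h2 : s < 3 * α + 1 := by nlinarith
  refine ⟨div_pos (by linarith) (by positivity), ?_, ?_⟩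
  · rw [div_lt_one (by positivity)]; linarith
  · field_simp
    nlinarith

theorem largeValue_eq_sixPointValue {α : ℝ} (hα : 0 < α) :
    largeValue α = sixPointValue α (sixPointParam α) := by
  have h := sixPointParam_isOptimalParam hα
  have hs : √(α ^ 2 + 6 * α + 1) = 2 * α * sixPointParam α + (α + 1) := by
    unfold sixPointParam; field_simp; ring
  obtain ⟨h0, -, -⟩ := h
  unfold largeValue sixPointValue
  rw [hs]
  set a := sixPointParam α
  rw [show (3 * α + 1 - (2 * α * a + (α + 1))) / (2 * α) = 1 - a by field_simp; ring,
    show (-(α + 1) + (2 * α * a + (α + 1))) / (α - 1 + (2 * α * a + (α + 1))) = a / (1 + a) by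
      rw [show α - 1 + (2 * α * a + (α + 1)) = 2 * α * (1 + a) by ring]; field_simp; ring]
  ring

/-- A quantitative form of `sixPointValue_le`, with an approximate critical point `b`; it follows
from `log x ≤ x - 1` applied to the two factors of the quotient. -/
theorem sixPointValue_le_mul_exp {α b z : ℝ} (hα : 0 ≤ α) (hb0 : 0 < b) (hb1 : b < 1)
    (hz0 : 0 < z) (hz1 : z < 1) :
    sixPointValue α z ≤
      sixPointValue α b * Real.exp ((z - b) * (1 / (b * (1 + z)) - α / (1 - b))) := by
  have e1 : (1 - z) ^ α ≤ (1 - b) ^ α * Real.exp (α * ((1 - z) / (1 - b) - 1)) := by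
    have hq : 0 < (1 - z) / (1 - b) := div_pos (by linarith) (by linarith)
    have h : ((1 - z) / (1 - b)) ^ α ≤ Real.exp (α * ((1 - z) / (1 - b) - 1)) := by
      rw [Real.rpow_def_of_pos hq]
      refine Real.exp_le_exp.2 ?_
      nlinarith [Real.log_le_sub_one_of_pos hq]
    rw [Real.div_rpow (by linarith) (by linarith), div_le_iff₀ (Real.rpow_pos_of_pos (by linarith) _)]
      at h
    linarith
  have e2 : 2 * z / (1 + z) ≤ 2 * b / (1 + b) * Real.exp ((z / (1 + z)) / (b / (1 + b)) - 1) := by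
    have hp : 0 < b / (1 + b) := by positivity
    have h := Real.add_one_le_exp ((z / (1 + z)) / (b / (1 + b)) - 1)
    rw [sub_add_cancel, div_le_iff₀ hp] at h
    calc 2 * z / (1 + z) = 2 * (z / (1 + z)) := by ring
      _ ≤ 2 * (Real.exp ((z / (1 + z)) / (b / (1 + b)) - 1) * (b / (1 + b))) := by linarith
      _ = _ := by ring
  have hb : 1 - b ≠ 0 := by linarith
  unfold sixPointValue
  calc 2 * z / (1 + z) * (1 - z) ^ α
      ≤ (2 * b / (1 + b) * Real.exp ((z / (1 + z)) / (b / (1 + b)) - 1)) *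
        ((1 - b) ^ α * Real.exp (α * ((1 - z) / (1 - b) - 1))) :=
        mul_le_mul e2 e1 (Real.rpow_nonneg (by linarith) _) (by positivity)
    _ = 2 * b / (1 + b) * (1 - b) ^ α * (Real.exp ((z / (1 + z)) / (b / (1 + b)) - 1) *
        Real.exp (α * ((1 - z) / (1 - b) - 1))) := by ring
    _ = _ := by
      rw [← Real.exp_add]
      congr 2
      field_simp
      ring

theorem IsOptimalParam.sixPointValue_le {α a z : ℝ} (h : IsOptimalParam α a) (hα : 0 < α)
    (hz0 : 0 ≤ z) (hz1 : z < 1) : sixPointValue α z ≤ sixPointValue α a := by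
  obtain ⟨h0, h1, he⟩ := h
  have hpos : 0 < sixPointValue α a :=
    mul_pos (by positivity) (Real.rpow_pos_of_pos (by linarith) _)
  rcases hz0.eq_or_lt with rfl | hz0
  · simpa [sixPointValue] using hpos.le
  refine (sixPointValue_le_mul_exp hα.le h0 h1 hz0 hz1).trans ?_
  refine mul_le_of_le_one_right hpos.le (Real.exp_le_one_iff.2 ?_)
  have e : α / (1 - a) = 1 / (a * (1 + a)) := by
    rw [div_eq_div_iff (by linarith) (by positivity)]; linarith
  have e2 : (z - a) * (1 / (a * (1 + z)) - 1 / (a * (1 + a))) =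
      -((z - a) ^ 2 / (a * (1 + z) * (1 + a))) := by
    field_simp; ring
  rw [e, e2]
  exact neg_nonpos.2 (by positivity)

/-! ### Threshold certificates -/

theorem convexOn_sinh : ConvexOn ℝ (Set.Ici 0) Real.sinh := by
  refine convexOn_of_deriv2_nonneg (convex_Ici 0) Real.continuous_sinh.continuousOn
    Real.differentiable_sinh.differentiableOn ?_ ?_
  · rw [Real.deriv_sinh]; exact Real.differentiable_cosh.differentiableOn
  · intro x hx
    rw [interior_Ici] at hx
    simp only [Function.iterate_succ, Function.iterate_zero, Function.comp_apply, Real.deriv_sinh,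
      Real.deriv_cosh, id]
    exact Real.sinh_nonneg_iff.2 (le_of_lt hx)

/-- The function `sinh` is convex on `[0, ∞)` and vanishes at `0`. -/
theorem mul_sinh_le_sinh_mul {n x : ℝ} (hn : 1 ≤ n) (hx : 0 ≤ x) :
    n * Real.sinh x ≤ Real.sinh (n * x) := by
  have hn0 : 0 < n := by linarith
  have hnx : n * x ∈ Set.Ici (0 : ℝ) := Set.mem_Ici.2 (by positivity)
  have hw : 0 ≤ 1 - 1 / n := by rw [sub_nonneg, div_le_one hn0]; exact hn
  have h := convexOn_sinh.2 (Set.mem_Ici.2 (le_refl (0 : ℝ))) hnx hw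
    (show 0 ≤ 1 / n by positivity) (by ring)
  simp only [smul_eq_mul, mul_zero, zero_add, Real.sinh_zero] at h
  rw [show 1 / n * (n * x) = x by field_simp] at h
  calc n * Real.sinh x ≤ n * (1 / n * Real.sinh (n * x)) := by gcongr
    _ = Real.sinh (n * x) := by field_simp

/-- The mean of `n s ^ (n - 1)` over `[s, 1]` is at least its value at the geometric midpoint. -/
theorem mul_one_sub_mul_rpow_le {n s : ℝ} (hn : 1 ≤ n) (hs0 : 0 < s) (hs1 : s ≤ 1) :
    n * (1 - s) * s ^ ((n - 1) / 2) ≤ 1 - s ^ n := by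
  obtain ⟨v, rfl⟩ : ∃ v, s = Real.exp (-v) := ⟨-Real.log s, by rw [neg_neg, Real.exp_log hs0]⟩
  have hv : 0 ≤ v := by
    have := Real.exp_le_one_iff.1 hs1; linarith
  have h := mul_sinh_le_sinh_mul hn (show 0 ≤ v / 2 by positivity)
  rw [← Real.exp_mul, ← Real.exp_mul]
  have e1 : 1 - Real.exp (-v * n) = 2 * Real.exp (-(n * v / 2)) * Real.sinh (n * (v / 2)) := by
    have h1 : Real.exp (-(n * v / 2)) * Real.exp (n * (v / 2)) = 1 := by
      rw [← Real.exp_add, ← Real.exp_zero]; congr 1; ring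
    have h2 : Real.exp (-(n * v / 2)) * Real.exp (-(n * (v / 2))) = Real.exp (-v * n) := by
      rw [← Real.exp_add]; congr 1; ring
    rw [Real.sinh_eq, ← h2]
    linear_combination -h1
  have e2 : (1 - Real.exp (-v)) * Real.exp (-v * ((n - 1) / 2)) =
      2 * Real.exp (-(n * v / 2)) * Real.sinh (v / 2) := by
    have h1 : Real.exp (-(n * v / 2)) * Real.exp (v / 2) = Real.exp (-v * ((n - 1) / 2)) := by
      rw [← Real.exp_add]; congr 1; ring
    have h2 : Real.exp (-(n * v / 2)) * Real.exp (-(v / 2)) =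
        Real.exp (-v) * Real.exp (-v * ((n - 1) / 2)) := by
      rw [← Real.exp_add, ← Real.exp_add]; congr 1; ring
    rw [Real.sinh_eq]
    linear_combination h2 - h1
  rw [mul_assoc, e1, e2]
  nlinarith [Real.exp_pos (-(n * v / 2))]

/-- The inequality behind the certificate on the part of `[0, 1/2]` where the threshold is not
active; near `y = 0` it amounts to `1 ≤ α t ^ (α - 1) + V`. -/
theorem rpow_sub_add_mul_rpow_le {α t V y : ℝ} (hα : 1 ≤ α) (ht : 1 / 2 ≤ t) (ht1 : t ≤ 1)
    (hV0 : 0 ≤ V) (hy0 : 0 ≤ y) (hy1 : y ≤ 1 - t) (hA : 1 ≤ α * t ^ (α - 1) + V)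
    (hcase : V = t ^ α ∨ α ≤ t * (2 * α - 1)) :
    (t - y) ^ α + y * (1 - y) ^ (α - 1) ≤ t ^ α + V * y / (1 - y) := by
  have ht0 : 0 < t := by linarith
  have hs0 : 0 < 1 - y := by linarith
  have hs1 : 1 - y ≤ 1 := by linarith
  have hα0 : 0 < α := by linarith
  set s := 1 - y with hs
  have hys : y = 1 - s := by rw [hs]; ring
  set n := α / t with hn
  have hn1 : 1 ≤ n := by rw [hn, le_div_iff₀ ht0]; linarith
  -- Bernoulli: `1 - y / t ≤ (1 - y) ^ (1 / t)`
  have b1 : (t - y) ^ α ≤ t ^ α * s ^ n := by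
    have h := one_add_mul_self_le_rpow_one_add (s := -y) (by linarith) (p := 1 / t)
      (by rw [le_div_iff₀ ht0]; linarith)
    rw [show 1 + -y = s by rw [hs]; ring] at h
    have h0 : 0 ≤ 1 + 1 / t * -y := by
      rw [show 1 + 1 / t * -y = (t - y) / t by field_simp; ring]
      exact div_nonneg (by linarith) ht0.le
    calc (t - y) ^ α = (t * (1 + 1 / t * -y)) ^ α := by congr 1; field_simp; ring
      _ = t ^ α * (1 + 1 / t * -y) ^ α := Real.mul_rpow ht0.le h0
      _ ≤ t ^ α * (s ^ (1 / t)) ^ α := by gcongr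
      _ = t ^ α * s ^ n := by rw [← Real.rpow_mul hs0.le, hn]; congr 2; ring
  have b2 := mul_one_sub_mul_rpow_le hn1 hs0 hs1
  have hT : t ^ α * n = α * t ^ (α - 1) := by
    rw [Real.rpow_sub_one ht0.ne', hn]; ring
  set A := α * t ^ (α - 1) with hAdef
  have hA0 : 0 ≤ A := by positivity
  have b3 : 1 ≤ A * s ^ ((n - 1) / 2 - (α - 1)) + V * s ^ (-α) := by
    rcases hcase with hc | hc
    · have hexp : s ^ ((1 : ℝ) / 2) ≤ s ^ ((n - 1) / 2 - (α - 1)) := by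
        refine Real.rpow_le_rpow_of_exponent_ge hs0 hs1 ?_
        have : n ≤ 2 * α := by rw [hn, div_le_iff₀ ht0]; nlinarith
        linarith
      set w := s ^ ((1 : ℝ) / 2) with hw
      have hw0 : 0 < w := Real.rpow_pos_of_pos hs0 _
      have hw1 : w ≤ 1 := Real.rpow_le_one hs0.le hs1 (by norm_num)
      have hws : s ^ (-α) = (w⁻¹) ^ (2 * α) := by
        rw [hw, ← Real.rpow_neg hs0.le, ← Real.rpow_mul hs0.le]; congr 1; ring
      -- Bernoulli, and `1 + (1 - w) ≤ w⁻¹`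
      have hbern : 1 + 2 * α * (1 - w) ≤ (w⁻¹) ^ (2 * α) := by
        have h := one_add_mul_self_le_rpow_one_add (s := 1 - w) (by linarith) (p := 2 * α)
          (by linarith)
        refine h.trans (Real.rpow_le_rpow (by linarith) ?_ (by linarith))
        rw [le_inv_comm₀ (by linarith) hw0, ← one_div, le_div_iff₀ (by linarith)]
        nlinarith [sq_nonneg (1 - w)]
      have hAV : A ≤ 2 * α * V := by
        rw [← hT, hc, hn, mul_div_assoc', div_le_iff₀ ht0]
        have : 0 ≤ t ^ α * α := by positivity
        nlinarith
      rw [hws]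
      have h1 : A * w ≤ A * s ^ ((n - 1) / 2 - (α - 1)) := by gcongr
      have h2 : V * (1 + 2 * α * (1 - w)) ≤ V * (w⁻¹) ^ (2 * α) := by gcongr
      nlinarith
    · have hexp : 1 ≤ s ^ ((n - 1) / 2 - (α - 1)) := by
        refine Real.one_le_rpow_of_pos_of_le_one_of_nonpos hs0 hs1 ?_
        have : n ≤ 2 * α - 1 := by rw [hn, div_le_iff₀ ht0]; linarith
        linarith
      have h2 : 1 ≤ s ^ (-α) := Real.one_le_rpow_of_pos_of_le_one_of_nonpos hs0 hs1 (by linarith)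
      nlinarith
  have hp : 0 < s ^ (α - 1) := Real.rpow_pos_of_pos hs0 _
  have e1 : s ^ (α - 1) * s ^ ((n - 1) / 2 - (α - 1)) = s ^ ((n - 1) / 2) := by
    rw [← Real.rpow_add hs0]; congr 1; ring
  have e2 : s ^ (α - 1) * s ^ (-α) = 1 / s := by
    rw [← Real.rpow_add hs0, show α - 1 + -α = -1 by ring, Real.rpow_neg_one, one_div]
  have b4 : s ^ (α - 1) ≤ A * s ^ ((n - 1) / 2) + V * (1 / s) := by
    rw [← e1, ← e2]
    nlinarith
  have b5 : t ^ α * (n * (1 - s) * s ^ ((n - 1) / 2)) ≤ t ^ α * (1 - s ^ n) := by gcongr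
  have b6 : y * s ^ (α - 1) ≤ y * (A * s ^ ((n - 1) / 2) + V * (1 / s)) := by gcongr
  have e3 : t ^ α * (n * (1 - s) * s ^ ((n - 1) / 2)) = y * (A * s ^ ((n - 1) / 2)) := by
    rw [← hT, hys]; ring
  have e4 : V * y / s = y * (V * (1 / s)) := by ring
  rw [e4]
  nlinarith

/-- The certificate with threshold `t`; `(1 - x) * thresholdCert α t V x` is the excess over `V` of
the larger one of `t ^ α` and `(1 - x) ^ α`. -/
noncomputable def thresholdCert (α t V x : ℝ) : ℝ := (max (t ^ α) ((1 - x) ^ α) - V) / (1 - x)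

theorem one_sub_mul_thresholdCert {α t V x : ℝ} (hx : x < 1) :
    (1 - x) * thresholdCert α t V x = max (t ^ α) ((1 - x) ^ α) - V := by
  unfold thresholdCert
  rw [mul_div_cancel₀]; linarith

/-- `s ↦ s ^ α - (s - y) ^ α` is nondecreasing. -/
theorem rpow_sub_rpow_sub_le {α s t y : ℝ} (hα : 1 ≤ α) (hy : 0 ≤ y) (hyt : y ≤ t) (hts : t ≤ s) :
    t ^ α - (t - y) ^ α ≤ s ^ α - (s - y) ^ α := by
  have hmono : MonotoneOn (fun s : ℝ => s ^ α - (s - y) ^ α) (Set.Ici y) := by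
    have hc : ContinuousOn (fun s : ℝ => s ^ α - (s - y) ^ α) (Set.Ici y) := by
      have c1 : Continuous fun s : ℝ => s ^ α :=
        continuous_id.rpow_const fun _ => Or.inr (by linarith)
      have c2 : Continuous fun s : ℝ => (s - y) ^ α :=
        (continuous_id.sub continuous_const).rpow_const fun _ => Or.inr (by linarith)
      exact (c1.sub c2).continuousOn
    have hd : ∀ s, HasDerivAt (fun s : ℝ => s ^ α - (s - y) ^ α)
        (α * s ^ (α - 1) - α * (s - y) ^ (α - 1)) s := by
      intro s
      have d1 := Real.hasDerivAt_rpow_const (x := s) (p := α) (Or.inr hα)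
      have d2 := (Real.hasDerivAt_rpow_const (x := s - y) (p := α) (Or.inr hα)).comp s
        ((hasDerivAt_id s).sub_const y)
      rw [mul_one] at d2
      exact d1.sub d2
    refine monotoneOn_of_deriv_nonneg (convex_Ici y) hc
      (fun s _ => (hd s).differentiableAt.differentiableWithinAt) ?_
    intro s hs
    rw [interior_Ici] at hs
    rw [(hd s).deriv, sub_nonneg]
    have : (s - y) ^ (α - 1) ≤ s ^ (α - 1) :=
      Real.rpow_le_rpow (by linarith [Set.mem_Ioi.1 hs]) (by linarith) (by linarith)
    gcongr
  exact hmono (Set.mem_Ici.2 hyt) (Set.mem_Ici.2 (hyt.trans hts)) hts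

/-- Weak duality for the threshold certificate. Of the conditions in `absDiffMoment_le_of_half`
only the one for two points of `[0, 1/2]` on the event `X = 0` has to be assumed, as `h0`; the
others hold for this certificate. -/
theorem IsCoherent.absDiffMoment_le_of_threshold {p : ℝ} {μ : Measure (ℝ × ℝ)}
    (hμ : IsCoherent.{u} p μ) {α t V : ℝ} (hα : 1 ≤ α) (ht : 1 / 2 ≤ t) (ht1 : t ≤ 1)
    (hV : (1 / 2 : ℝ) ^ α ≤ V) (hVT : V ≤ t ^ α) (hA : 1 ≤ α * t ^ (α - 1) + V)
    (hcase : V = t ^ α ∨ α ≤ t * (2 * α - 1))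
    (h0 : ∀ x y, 0 ≤ x → x ≤ y → y ≤ 1 / 2 →
      (y - x) ^ α ≤ V - x * thresholdCert α t V x - y * thresholdCert α t V y) :
    absDiffMoment α μ ≤ V := by
  have hα0 : 0 < α := by linarith
  have ht0 : 0 < t := by linarith
  have hV0 : 0 ≤ V := (Real.rpow_nonneg (by norm_num) _).trans hV
  have hmax : ∀ x, 0 ≤ max (t ^ α) ((1 - x) ^ α) - V := fun x =>
    sub_nonneg.2 (hVT.trans (le_max_left _ _))
  have hT1 : t ^ α ≤ 1 := Real.rpow_le_one ht0.le ht1 hα0.le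
  have hmeas : Measurable (thresholdCert α t V) := by
    have : Measurable fun x : ℝ => (1 - x) ^ α := by fun_prop
    exact ((measurable_const.max this).sub measurable_const).div
      (measurable_const.sub measurable_id)
  refine hμ.absDiffMoment_le_of_half (g := thresholdCert α t V) (C := 2) hα0 hmeas ?_ ?_ ?_ ?_
  · rintro x ⟨hx0, hx1⟩
    have hm1 : max (t ^ α) ((1 - x) ^ α) ≤ 1 :=
      max_le hT1 (Real.rpow_le_one (by linarith) (by linarith) hα0.le)
    unfold thresholdCert
    rw [abs_of_nonneg (div_nonneg (hmax x) (by linarith)), div_le_iff₀ (by linarith)]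
    linarith
  · rintro x ⟨hx0, hx1⟩ y ⟨hy0, hy1⟩
    rw [one_sub_mul_thresholdCert (by linarith), one_sub_mul_thresholdCert (by linarith)]
    have : |x - y| ^ α ≤ (1 / 2 : ℝ) ^ α :=
      Real.rpow_le_rpow (abs_nonneg _) (abs_le.2 ⟨by linarith, by linarith⟩) hα0.le
    linarith [hmax x, hmax y]
  · rintro x ⟨hx0, hx1⟩ y ⟨hy0, hy1⟩
    rcases le_total x y with h | h
    · rw [abs_sub_comm, abs_of_nonneg (by linarith)]; exact h0 x y hx0 h hy1
    · rw [abs_of_nonneg (by linarith)]; linarith [h0 y x hy0 h hx1]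
  · rintro x ⟨hx0, hx1⟩ y ⟨hy0, hy1⟩
    have hys : 0 < 1 - y := by linarith
    rw [one_sub_mul_thresholdCert (by linarith)]
    have step1 : t ^ α - (t - y) ^ α ≤ max (t ^ α) ((1 - x) ^ α) - (1 - x - y) ^ α := by
      rcases le_total t (1 - x) with h | h
      · exact (rpow_sub_rpow_sub_le hα hy0 (by linarith) h).trans
          (sub_le_sub_right (le_max_right _ _) _)
      · have : (1 - x - y) ^ α ≤ (t - y) ^ α :=
          Real.rpow_le_rpow (by linarith) (by linarith) hα0.le
        linarith [le_max_left (t ^ α) ((1 - x) ^ α)]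
    have step2 : y * thresholdCert α t V y ≤ t ^ α - (t - y) ^ α := by
      unfold thresholdCert
      rcases le_total (t ^ α) ((1 - y) ^ α) with h | h
      · rw [max_eq_right h]
        have hty : y ≤ 1 - t := by
          have := (Real.rpow_le_rpow_iff ht0.le hys.le hα0).1 h
          linarith
        have := rpow_sub_add_mul_rpow_le hα ht ht1 hV0 hy0 hty hA hcase
        rw [Real.rpow_sub_one hys.ne'] at this
        have e : y * (((1 - y) ^ α - V) / (1 - y)) =
          y * ((1 - y) ^ α / (1 - y)) - V * y / (1 - y) := by ring
        rw [e]; linarith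
      · rw [max_eq_left h]
        -- `t - y` is at most the average of `t` and `1/2` with weights `1 - l` and `l`.
        set l := y / (1 - y) with hl
        have hl0 : 0 ≤ l := div_nonneg hy0 hys.le
        have hl1 : l ≤ 1 := (div_le_one hys).2 (by linarith)
        have hcv := (convexOn_rpow hα).2 (Set.mem_Ici.2 ht0.le)
          (Set.mem_Ici.2 (show (0 : ℝ) ≤ 1 / 2 by norm_num)) (sub_nonneg.2 hl1) hl0 (by ring)
        simp only [smul_eq_mul] at hcv
        have hle : t - y ≤ (1 - l) * t + l * (1 / 2) := by
          have : (1 - l) * t + l * (1 / 2) - (t - y) = y * (3 / 2 - y - t) / (1 - y) := by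
            rw [hl]; field_simp; ring
          have h' : 0 ≤ y * (3 / 2 - y - t) / (1 - y) :=
            div_nonneg (mul_nonneg hy0 (by linarith)) hys.le
          linarith
        have h2 := (Real.rpow_le_rpow (by linarith) hle hα0.le).trans hcv
        have h3 : l * (1 / 2 : ℝ) ^ α ≤ l * V := by gcongr
        have e : y * ((t ^ α - V) / (1 - y)) = l * (t ^ α - V) := by rw [hl]; ring
        rw [e]; linarith
    linarith

/-! ### Comparison of three-point averages with a six-point law -/

/-- In the barycentric coordinates `x`, `v = y - x`, `w = 1/2 - y` of the triangle
`0 ≤ x ≤ y ≤ 1/2`, with `1 = 2 (x + v + w)` used to homogenise, the difference of the two sides is a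
multiple of `v ^ 2` times a form with nonnegative coefficients. The three lemmas that follow have the
same proof; they are polynomial bounds for the same inequality with the exponents `4`, `7/3` and
`9/4`, the last one on a smaller triangle. -/
theorem three_point_cubic {x y : ℝ} (hx : 0 ≤ x) (hxy : x ≤ y) (hy : y ≤ 1 / 2) :
    (1 + (x + y) / 2) * (x * (1 - y) * (1 - x) ^ 3 +
      y * (1 - x) * (1 - y) ^ 3 +
      (1 - x) * (1 - y) * (y - x) ^ 3) ≤
      (x + y) * (1 - x * y) * (1 - (x + y) / 2) ^ 3 := by
  obtain ⟨v, rfl⟩ : ∃ v, y = x + v := ⟨y - x, by ring⟩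
  obtain ⟨w, hw⟩ : ∃ w, w = 1 / 2 - x - v := ⟨_, rfl⟩
  have hv : 0 ≤ v := by linarith
  have hw0 : 0 ≤ w := by linarith
  have h : 0 ≤ v ^ 2 * (
      7 / 2 * x ^ 4 + 31 / 2 * x ^ 3 * v + 23 * x ^ 3 * w + 193 / 8 * x ^ 2 * v ^ 2 +
      149 / 2 * x ^ 2 * v * w + 54 * x ^ 2 * w ^ 2 + 125 / 8 * x * v ^ 3 +
      149 / 2 * x * v ^ 2 * w + 112 * x * v * w ^ 2 + 52 * x * w ^ 3 + 7 / 2 * v ^ 4 +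
      23 * v ^ 3 * w + 107 / 2 * v ^ 2 * w ^ 2 + 50 * v * w ^ 3 + 16 * w ^ 4) := by
    positivity
  rw [hw] at h
  linarith

theorem three_point_quartic {x y : ℝ} (hx : 0 ≤ x) (hxy : x ≤ y) (hy : y ≤ 1 / 2) :
    (1 + (x + y) / 2) * (x * (1 - y) * (1 - x) ^ 4 +
      y * (1 - x) * (1 - y) ^ 4 +
      (1 - x) * (1 - y) * (y - x) ^ 4) ≤
      (x + y) * (1 - x * y) * (1 - (x + y) / 2) ^ 4 := by
  obtain ⟨v, rfl⟩ : ∃ v, y = x + v := ⟨y - x, by ring⟩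
  obtain ⟨w, hw⟩ : ∃ w, w = 1 / 2 - x - v := ⟨_, rfl⟩
  have hv : 0 ≤ v := by linarith
  have hw0 : 0 ≤ w := by linarith
  have h : 0 ≤ v ^ 2 * (
      2 * x ^ 5 + 33 / 2 * x ^ 4 * v + 23 * x ^ 4 * w + 395 / 8 * x ^ 3 * v ^ 2 +
      142 * x ^ 3 * v * w + 96 * x ^ 3 * w ^ 2 + 1081 / 16 * x ^ 2 * v ^ 3 +
      302 * x ^ 2 * v ^ 2 * w + 420 * x ^ 2 * v * w ^ 2 + 184 * x ^ 2 * w ^ 3 +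
      687 / 16 * x * v ^ 4 + 527 / 2 * x * v ^ 3 * w + 1129 / 2 * x * v ^ 2 * w ^ 2 +
      504 * x * v * w ^ 3 + 160 * x * w ^ 4 + 41 / 4 * v ^ 5 + 161 / 2 * v ^ 4 * w +
      937 / 4 * v ^ 3 * w ^ 2 + 316 * v ^ 2 * w ^ 3 + 200 * v * w ^ 4 + 48 * w ^ 5) := by
    positivity
  rw [hw] at h
  linarith

theorem three_point_seven_thirds {x y : ℝ} (hx : 0 ≤ x) (hxy : x ≤ y) (hy : y ≤ 1 / 2) :
    (1 + (x + y) / 2) * (x * (1 - y) * (2 / 3 * ((1 - x) ^ 2 * (1 - (x + y) / 2)) +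
        1 / 3 * (1 - x) ^ 3) +
      y * (1 - x) * (2 / 3 * ((1 - y) ^ 2 * (1 - (x + y) / 2)) +
        1 / 3 * (1 - y) ^ 3) +
      (1 - x) * (1 - y) * (2 / 3 * ((y - x) ^ 2 * (1 - (x + y) / 2)) +
        1 / 3 * (y - x) ^ 3)) ≤
      (x + y) * (1 - x * y) * (1 - (x + y) / 2) ^ 3 := by
  obtain ⟨v, rfl⟩ : ∃ v, y = x + v := ⟨y - x, by ring⟩
  obtain ⟨w, hw⟩ : ∃ w, w = 1 / 2 - x - v := ⟨_, rfl⟩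
  have hv : 0 ≤ v := by linarith
  have hw0 : 0 ≤ w := by linarith
  have h : 0 ≤ v ^ 2 * (
      3 / 2 * x ^ 4 + 35 / 6 * x ^ 3 * v + 23 / 3 * x ^ 3 * w + 179 / 24 * x ^ 2 * v ^ 2 +
      39 / 2 * x ^ 2 * v * w + 38 / 3 * x ^ 2 * w ^ 2 + 79 / 24 * x * v ^ 3 +
      73 / 6 * x * v ^ 2 * w + 16 * x * v * w ^ 2 + 20 / 3 * x * w ^ 3 + 1 / 6 * v ^ 4 +
      1 / 3 * v ^ 3 * w + 5 / 6 * v ^ 2 * w ^ 2 + 2 / 3 * v * w ^ 3) := by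
    positivity
  rw [hw] at h
  linarith

theorem three_point_nine_fourths {x y : ℝ} (hx : 1 / 25 ≤ x) (hxy : x ≤ y) (hy : y ≤ 1 / 2) :
    (1 + (x + y) / 2) * (x * (1 - y) * (3 / 4 * ((1 - x) ^ 2 * (1 - (x + y) / 2)) +
        1 / 4 * (1 - x) ^ 3) +
      y * (1 - x) * (3 / 4 * ((1 - y) ^ 2 * (1 - (x + y) / 2)) +
        1 / 4 * (1 - y) ^ 3) +
      (1 - x) * (1 - y) * (5 / 8 * ((y - x) ^ 2 * (1 - (x + y) / 2)) +
        54 / 125 * (y - x) ^ 3)) ≤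
      (x + y) * (1 - x * y) * (1 - (x + y) / 2) ^ 3 := by
  obtain ⟨u, rfl⟩ : ∃ u, x = u + 1 / 25 := ⟨x - 1 / 25, by ring⟩
  obtain ⟨v, rfl⟩ : ∃ v, y = u + 1 / 25 + v := ⟨y - (u + 1 / 25), by ring⟩
  obtain ⟨w, hw⟩ : ∃ w, w = 23 / 50 - u - v := ⟨_, rfl⟩
  have hu : 0 ≤ u := by linarith
  have hv : 0 ≤ v := by linarith
  have hw0 : 0 ≤ w := by linarith
  have h : 0 ≤ v ^ 2 * (
      5078125 / 2238728 * u ^ 4 + 19102125 / 2238728 * u ^ 3 * v +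
      12671875 / 1119364 * u ^ 3 * w + 92948475 / 8954912 * u ^ 2 * v ^ 2 +
      62719425 / 2238728 * u ^ 2 * v * w + 5199375 / 279841 * u ^ 2 * w ^ 2 +
      186431663 / 44774560 * u * v ^ 3 + 188286731 / 11193640 * u * v ^ 2 * w +
      32974107 / 1399205 * u * v * w ^ 2 + 2901600 / 279841 * u * w ^ 3 +
      271161 / 5596820 * v ^ 4 + 33531053 / 139920500 * v ^ 3 * w +
      64292471 / 34980125 * v ^ 2 * w ^ 2 + 82660464 / 34980125 * v * w ^ 3 +
      200448 / 279841 * w ^ 4) := by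
    positivity
  rw [hw] at h
  linarith

/-- Weighted AM-GM: `t ^ α` lies below the chord of `a ↦ t ^ a`. -/
theorem rpow_le_chord {t a b α : ℝ} (ht : 0 ≤ t) (ha : 0 < a) (hab : a < b) (h1 : a ≤ α)
    (h2 : α ≤ b) : t ^ α ≤ (b - α) / (b - a) * t ^ a + (α - a) / (b - a) * t ^ b := by
  have hba : 0 < b - a := by linarith
  rcases ht.eq_or_lt with rfl | ht
  · rw [Real.zero_rpow (by linarith), Real.zero_rpow (by linarith), Real.zero_rpow (by linarith)]
    simp
  have h := Real.geom_mean_le_arith_mean2_weighted (w₁ := (b - α) / (b - a))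
    (w₂ := (α - a) / (b - a)) (div_nonneg (by linarith) hba.le) (div_nonneg (by linarith) hba.le)
    (Real.rpow_nonneg ht.le a) (Real.rpow_nonneg ht.le b) (by field_simp; ring)
  rw [← Real.rpow_mul ht.le, ← Real.rpow_mul ht.le, ← Real.rpow_add ht] at h
  rwa [show a * ((b - α) / (b - a)) + b * ((α - a) / (b - a)) = α by field_simp; ring] at h

/-- A nonnegative combination of `α`-th powers is convex in `α`, so an upper bound propagates from
the ends of an interval to its interior. -/
theorem sum_rpow_le_of_endpoints {W₁ W₂ W₃ t₁ t₂ t₃ C a b α : ℝ} (hW₁ : 0 ≤ W₁) (hW₂ : 0 ≤ W₂)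
    (hW₃ : 0 ≤ W₃) (ht₁ : 0 ≤ t₁) (ht₂ : 0 ≤ t₂) (ht₃ : 0 ≤ t₃) (ha : 0 < a) (hab : a < b)
    (h1 : a ≤ α) (h2 : α ≤ b) (hCa : W₁ * t₁ ^ a + W₂ * t₂ ^ a + W₃ * t₃ ^ a ≤ C)
    (hCb : W₁ * t₁ ^ b + W₂ * t₂ ^ b + W₃ * t₃ ^ b ≤ C) :
    W₁ * t₁ ^ α + W₂ * t₂ ^ α + W₃ * t₃ ^ α ≤ C := by
  have hba : 0 < b - a := by linarith
  set l := (b - α) / (b - a) with hl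
  set r := (α - a) / (b - a) with hr
  have hlr : l + r = 1 := by rw [hl, hr]; field_simp; ring
  have hl0 : 0 ≤ l := div_nonneg (by linarith) hba.le
  have hr0 : 0 ≤ r := div_nonneg (by linarith) hba.le
  have e₁ := mul_le_mul_of_nonneg_left (rpow_le_chord ht₁ ha hab h1 h2) hW₁
  have e₂ := mul_le_mul_of_nonneg_left (rpow_le_chord ht₂ ha hab h1 h2) hW₂
  have e₃ := mul_le_mul_of_nonneg_left (rpow_le_chord ht₃ ha hab h1 h2) hW₃
  have ea := mul_le_mul_of_nonneg_left hCa hl0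
  have eb := mul_le_mul_of_nonneg_left hCb hr0
  have hC : C = l * C + r * C := by rw [← add_mul, hlr, one_mul]
  rw [hC]
  linarith

theorem rpow_seven_thirds_le {t : ℝ} (ht : 0 ≤ t) :
    t ^ (7 / 3 : ℝ) ≤ 2 / 3 * t ^ 2 + 1 / 3 * t ^ 3 := by
  have h := rpow_le_chord (a := (2 : ℕ)) (b := (3 : ℕ)) (α := 7 / 3) ht (by norm_num) (by norm_num)
    (by norm_num) (by norm_num)
  rw [Real.rpow_natCast, Real.rpow_natCast] at h
  norm_num at h ⊢
  linarith

theorem rpow_nine_fourths_le {t : ℝ} (ht : 0 ≤ t) :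
    t ^ (9 / 4 : ℝ) ≤ 3 / 4 * t ^ 2 + 1 / 4 * t ^ 3 := by
  have h := rpow_le_chord (a := (2 : ℕ)) (b := (3 : ℕ)) (α := 9 / 4) ht (by norm_num) (by norm_num)
    (by norm_num) (by norm_num)
  rw [Real.rpow_natCast, Real.rpow_natCast] at h
  norm_num at h ⊢
  linarith

/-- The bound of `rpow_nine_fourths_le` rescaled so that it is sharp at `t = (5 / 6) ^ 4`, in the
range that matters for the smallest term `(y - x) ^ α`. -/
theorem rpow_nine_fourths_le' {t : ℝ} (ht : 0 ≤ t) :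
    t ^ (9 / 4 : ℝ) ≤ 5 / 8 * t ^ 2 + 54 / 125 * t ^ 3 := by
  have hs : (0 : ℝ) ≤ 5 / 6 := by norm_num
  have h := rpow_nine_fourths_le (t := t / (5 / 6) ^ (4 : ℝ)) (by positivity)
  rw [Real.div_rpow ht (by positivity), ← Real.rpow_mul hs, div_le_iff₀ (by positivity),
    show (4 : ℝ) * (9 / 4) = (9 : ℕ) by norm_num, show (4 : ℝ) = (4 : ℕ) by norm_num,
    Real.rpow_natCast, Real.rpow_natCast] at h
  refine h.trans (le_of_eq ?_)
  ring

section ThreePoint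

variable {x y : ℝ}

theorem three_point_normalized_three (hx : 0 ≤ x) (hxy : x ≤ y) (hy : y ≤ 1 / 2) :
    x * (1 - y) * ((1 - x) / (1 - (x + y) / 2)) ^ (3 : ℝ) +
      y * (1 - x) * ((1 - y) / (1 - (x + y) / 2)) ^ (3 : ℝ) +
      (1 - x) * (1 - y) * ((y - x) / (1 - (x + y) / 2)) ^ (3 : ℝ) ≤
      (x + y) / (1 + (x + y) / 2) * (1 - x * y) := by
  have h := three_point_cubic hx hxy hy
  have hM : 0 < 1 - (x + y) / 2 := by linarith
  have hm : 0 < 1 + (x + y) / 2 := by linarith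
  set M := 1 - (x + y) / 2
  rw [show (3 : ℝ) = (3 : ℕ) by norm_num, Real.rpow_natCast, Real.rpow_natCast, Real.rpow_natCast]
  rw [div_mul_eq_mul_div (x + y), le_div_iff₀ hm, ← mul_le_mul_iff_left₀ (pow_pos hM 3)]
  refine le_trans (le_of_eq ?_) h
  field_simp

theorem three_point_normalized_four (hx : 0 ≤ x) (hxy : x ≤ y) (hy : y ≤ 1 / 2) :
    x * (1 - y) * ((1 - x) / (1 - (x + y) / 2)) ^ (4 : ℝ) +
      y * (1 - x) * ((1 - y) / (1 - (x + y) / 2)) ^ (4 : ℝ) +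
      (1 - x) * (1 - y) * ((y - x) / (1 - (x + y) / 2)) ^ (4 : ℝ) ≤
      (x + y) / (1 + (x + y) / 2) * (1 - x * y) := by
  have h := three_point_quartic hx hxy hy
  have hM : 0 < 1 - (x + y) / 2 := by linarith
  have hm : 0 < 1 + (x + y) / 2 := by linarith
  set M := 1 - (x + y) / 2
  rw [show (4 : ℝ) = (4 : ℕ) by norm_num, Real.rpow_natCast, Real.rpow_natCast, Real.rpow_natCast]
  rw [div_mul_eq_mul_div (x + y), le_div_iff₀ hm, ← mul_le_mul_iff_left₀ (pow_pos hM 4)]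
  refine le_trans (le_of_eq ?_) h
  field_simp

theorem three_point_normalized_seven_thirds (hx : 0 ≤ x) (hxy : x ≤ y) (hy : y ≤ 1 / 2) :
    x * (1 - y) * ((1 - x) / (1 - (x + y) / 2)) ^ (7 / 3 : ℝ) +
      y * (1 - x) * ((1 - y) / (1 - (x + y) / 2)) ^ (7 / 3 : ℝ) +
      (1 - x) * (1 - y) * ((y - x) / (1 - (x + y) / 2)) ^ (7 / 3 : ℝ) ≤
      (x + y) / (1 + (x + y) / 2) * (1 - x * y) := by
  have h := three_point_seven_thirds hx hxy hy
  have hM : 0 < 1 - (x + y) / 2 := by linarith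
  have hm : 0 < 1 + (x + y) / 2 := by linarith
  set M := 1 - (x + y) / 2
  have e₁ := rpow_seven_thirds_le (t := (1 - x) / M) (div_nonneg (by linarith) hM.le)
  have e₂ := rpow_seven_thirds_le (t := (1 - y) / M) (div_nonneg (by linarith) hM.le)
  have e₃ := rpow_seven_thirds_le (t := (y - x) / M) (div_nonneg (by linarith) hM.le)
  have w₁ : 0 ≤ x * (1 - y) := mul_nonneg hx (by linarith)
  have w₂ : 0 ≤ y * (1 - x) := mul_nonneg (by linarith) (by linarith)
  have w₃ : 0 ≤ (1 - x) * (1 - y) := mul_nonneg (by linarith) (by linarith)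
  refine (add_le_add (add_le_add (mul_le_mul_of_nonneg_left e₁ w₁)
    (mul_le_mul_of_nonneg_left e₂ w₂)) (mul_le_mul_of_nonneg_left e₃ w₃)).trans ?_
  rw [div_mul_eq_mul_div (x + y), le_div_iff₀ hm, ← mul_le_mul_iff_left₀ (pow_pos hM 3)]
  refine le_trans (le_of_eq ?_) h
  field_simp

theorem three_point_normalized_nine_fourths (hx : 1 / 25 ≤ x) (hxy : x ≤ y) (hy : y ≤ 1 / 2) :
    x * (1 - y) * ((1 - x) / (1 - (x + y) / 2)) ^ (9 / 4 : ℝ) +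
      y * (1 - x) * ((1 - y) / (1 - (x + y) / 2)) ^ (9 / 4 : ℝ) +
      (1 - x) * (1 - y) * ((y - x) / (1 - (x + y) / 2)) ^ (9 / 4 : ℝ) ≤
      (x + y) / (1 + (x + y) / 2) * (1 - x * y) := by
  have h := three_point_nine_fourths hx hxy hy
  have hM : 0 < 1 - (x + y) / 2 := by linarith
  have hm : 0 < 1 + (x + y) / 2 := by linarith
  set M := 1 - (x + y) / 2
  have e₁ := rpow_nine_fourths_le (t := (1 - x) / M) (div_nonneg (by linarith) hM.le)
  have e₂ := rpow_nine_fourths_le (t := (1 - y) / M) (div_nonneg (by linarith) hM.le)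
  have e₃ := rpow_nine_fourths_le' (t := (y - x) / M) (div_nonneg (by linarith) hM.le)
  have w₁ : 0 ≤ x * (1 - y) := mul_nonneg (by linarith) (by linarith)
  have w₂ : 0 ≤ y * (1 - x) := mul_nonneg (by linarith) (by linarith)
  have w₃ : 0 ≤ (1 - x) * (1 - y) := mul_nonneg (by linarith) (by linarith)
  refine (add_le_add (add_le_add (mul_le_mul_of_nonneg_left e₁ w₁)
    (mul_le_mul_of_nonneg_left e₂ w₂)) (mul_le_mul_of_nonneg_left e₃ w₃)).trans ?_
  rw [div_mul_eq_mul_div (x + y), le_div_iff₀ hm, ← mul_le_mul_iff_left₀ (pow_pos hM 3)]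
  refine le_trans (le_of_eq ?_) h
  field_simp

/-- The three-point average against the six-point law with parameter `(x + y) / 2`. -/
theorem three_point_le_sixPointValue {α : ℝ} (hα : 9 / 4 ≤ α) (hα4 : α ≤ 4) (hx : 0 ≤ x)
    (hxy : x ≤ y) (hy : y ≤ 1 / 2) (h : 7 / 3 ≤ α ∨ 1 / 25 ≤ x) :
    x * (1 - y) * (1 - x) ^ α + y * (1 - x) * (1 - y) ^ α + (1 - x) * (1 - y) * (y - x) ^ α ≤
      sixPointValue α ((x + y) / 2) * (1 - x * y) := by
  have hM : 0 < 1 - (x + y) / 2 := by linarith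
  have h1x : 0 ≤ 1 - x := by linarith
  have h1y : 0 ≤ 1 - y := by linarith
  have hyx : 0 ≤ y - x := by linarith
  have w₁ : 0 ≤ x * (1 - y) := mul_nonneg hx h1y
  have w₂ : 0 ≤ y * (1 - x) := mul_nonneg (by linarith) h1x
  have w₃ : 0 ≤ (1 - x) * (1 - y) := mul_nonneg h1x h1y
  have h3 := three_point_normalized_three hx hxy hy
  have key : x * (1 - y) * ((1 - x) / (1 - (x + y) / 2)) ^ α +
      y * (1 - x) * ((1 - y) / (1 - (x + y) / 2)) ^ α +
      (1 - x) * (1 - y) * ((y - x) / (1 - (x + y) / 2)) ^ α ≤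
      (x + y) / (1 + (x + y) / 2) * (1 - x * y) := by
    rcases le_total α 3 with h' | h'
    · rcases h with h | h
      · exact sum_rpow_le_of_endpoints w₁ w₂ w₃ (by positivity) (by positivity) (by positivity)
          (by norm_num) (by norm_num) h h' (three_point_normalized_seven_thirds hx hxy hy) h3
      · exact sum_rpow_le_of_endpoints w₁ w₂ w₃ (by positivity) (by positivity) (by positivity)
          (by norm_num) (by norm_num) hα h' (three_point_normalized_nine_fourths h hxy hy) h3
    · exact sum_rpow_le_of_endpoints w₁ w₂ w₃ (by positivity) (by positivity) (by positivity)
        (by norm_num) (by norm_num) h' hα4 h3 (three_point_normalized_four hx hxy hy)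
  have hD : 0 < (1 - (x + y) / 2) ^ α := Real.rpow_pos_of_pos hM _
  rw [Real.div_rpow h1x hM.le, Real.div_rpow h1y hM.le, Real.div_rpow hyx hM.le,
    ← mul_le_mul_iff_left₀ hD] at key
  unfold sixPointValue
  rw [mul_div_cancel₀ (x + y) two_ne_zero]
  set D := (1 - (x + y) / 2) ^ α
  refine le_trans (le_of_eq ?_) (key.trans (le_of_eq ?_))
  · linear_combination -(x * (1 - y)) * div_mul_cancel₀ ((1 - x) ^ α) hD.ne' -
      y * (1 - x) * div_mul_cancel₀ ((1 - y) ^ α) hD.ne' -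
      (1 - x) * (1 - y) * div_mul_cancel₀ ((y - x) ^ α) hD.ne'
  · ring

/-- Near `x = 0` and for `α` close to the critical exponent the six-point laws do not suffice and
the competitor is `2 ^ (-α)`. -/
theorem three_point_le_half_rpow {α : ℝ} (hα : 2 ≤ α) (hα1 : α ≤ 7 / 3) (hx : 0 ≤ x)
    (hx1 : x ≤ 1 / 25) (hxy : x ≤ y) (hy : y ≤ 1 / 2) :
    x * (1 - y) * (1 - x) ^ α + y * (1 - x) * (1 - y) ^ α + (1 - x) * (1 - y) * (y - x) ^ α ≤
      (1 / 2 : ℝ) ^ α * (1 - x * y) := by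
  have h1x : 0 ≤ 1 - x := by linarith
  have h1y : 0 ≤ 1 - y := by linarith
  have hyx : 0 ≤ y - x := by linarith
  have w₁ : 0 ≤ x * (1 - y) := mul_nonneg hx h1y
  have w₂ : 0 ≤ y * (1 - x) := mul_nonneg (by linarith) h1x
  have w₃ : 0 ≤ (1 - x) * (1 - y) := mul_nonneg h1x h1y
  have h2 : x * (1 - y) * ((1 - x) / (1 / 2)) ^ (2 : ℝ) +
      y * (1 - x) * ((1 - y) / (1 / 2)) ^ (2 : ℝ) +
      (1 - x) * (1 - y) * ((y - x) / (1 / 2)) ^ (2 : ℝ) ≤ 1 - x * y := by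
    rw [show (2 : ℝ) = (2 : ℕ) by norm_num, Real.rpow_natCast, Real.rpow_natCast,
      Real.rpow_natCast]
    push_cast
    have hxyq : 0 ≤ x * y * (4 * ((1 - x) * (1 - y)) - 1) :=
      mul_nonneg (mul_nonneg hx (by linarith)) (by nlinarith)
    nlinarith [sq_nonneg (1 - 2 * ((1 - x) * (1 - y)))]
  have h73 : x * (1 - y) * ((1 - x) / (1 / 2)) ^ (7 / 3 : ℝ) +
      y * (1 - x) * ((1 - y) / (1 / 2)) ^ (7 / 3 : ℝ) +
      (1 - x) * (1 - y) * ((y - x) / (1 / 2)) ^ (7 / 3 : ℝ) ≤ 1 - x * y := by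
    have e₁ := rpow_seven_thirds_le (t := (1 - x) / (1 / 2)) (by positivity)
    have e₂ := rpow_seven_thirds_le (t := (1 - y) / (1 / 2)) (by positivity)
    have e₃ := rpow_seven_thirds_le (t := (y - x) / (1 / 2)) (by positivity)
    refine (add_le_add (add_le_add (mul_le_mul_of_nonneg_left e₁ w₁)
      (mul_le_mul_of_nonneg_left e₂ w₂)) (mul_le_mul_of_nonneg_left e₃ w₃)).trans ?_
    -- the difference vanishes at `x = 0`, `y = 1/2`, hence the local coordinate `u = 1 - 2 y`
    obtain ⟨u, rfl⟩ : ∃ u, y = (1 - u) / 2 := ⟨1 - 2 * y, by ring⟩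
    have hu0 : 0 ≤ u := by linarith
    have hu1 : u ≤ 1 := by linarith
    have hu2 : 0 ≤ u ^ 2 := sq_nonneg u
    have p1 : 0 ≤ (1 / 25 - x) * x := mul_nonneg (by linarith) hx
    have p2 : 0 ≤ (1 / 25 - x) * u ^ 2 := mul_nonneg (by linarith) hu2
    have p3 : 0 ≤ x * u ^ 2 * (1 - u ^ 2) := mul_nonneg (by positivity) (by nlinarith)
    have p4 : 0 ≤ x ^ 2 * (1 / 25 - x) := mul_nonneg (by positivity) (by linarith)
    have p5 : 0 ≤ x ^ 2 * u * (1 - x) := mul_nonneg (by positivity) (by linarith)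
    have p6 : 0 ≤ x ^ 2 * u ^ 2 * (1 - u) := mul_nonneg (by positivity) (by linarith)
    have p7 : 0 ≤ x ^ 2 * u ^ 2 * (1 - x) := mul_nonneg (by positivity) (by linarith)
    have p8 : 0 ≤ x * u ^ 3 := by positivity
    have p9 : 0 ≤ u ^ 4 := by positivity
    have p10 : 0 ≤ x ^ 2 * u := by positivity
    linarith [sq_nonneg (u - 95 / 32 * x), sq_nonneg (x * u), sq_nonneg x]
  have key := sum_rpow_le_of_endpoints w₁ w₂ w₃ (by positivity) (by positivity) (by positivity)
    (by norm_num) (by norm_num) hα hα1 h2 h73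
  rw [Real.div_rpow h1x (by norm_num), Real.div_rpow h1y (by norm_num),
    Real.div_rpow hyx (by norm_num)] at key
  have hD : 0 < (1 / 2 : ℝ) ^ α := by positivity
  set D := (1 / 2 : ℝ) ^ α
  rw [← mul_le_mul_iff_left₀ hD] at key
  refine le_trans (le_of_eq ?_) (key.trans (le_of_eq ?_))
  · linear_combination -(x * (1 - y)) * div_mul_cancel₀ ((1 - x) ^ α) hD.ne' -
      y * (1 - x) * div_mul_cancel₀ ((1 - y) ^ α) hD.ne' -
      (1 - x) * (1 - y) * div_mul_cancel₀ ((y - x) ^ α) hD.ne'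
  · ring

end ThreePoint

/-! ### Exponents between `9/4` and `4` -/

section TwoPoint

variable {x α : ℝ}

/-- The two-point analogue of `three_point_le_half_rpow`: the threshold is active at `y`, where the
certificate vanishes, and `y - x ≤ 1/2 - x`. -/
theorem two_point_le_half_rpow (hα : 2 ≤ α) (hα1 : α ≤ 7 / 3) (hx : 0 ≤ x) (hx1 : x ≤ 1 / 2) :
    x * (1 - x) ^ α + (1 - x) * (1 / 2 - x) ^ α ≤ (1 / 2 : ℝ) ^ α := by
  have h1x : 0 ≤ 1 - x := by linarith
  have h2x : 0 ≤ 1 / 2 - x := by linarith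
  have h2 : x * ((1 - x) / (1 / 2)) ^ (2 : ℝ) + (1 - x) * ((1 / 2 - x) / (1 / 2)) ^ (2 : ℝ) +
      0 * (0 : ℝ) ^ (2 : ℝ) ≤ 1 := by
    rw [show (2 : ℝ) = (2 : ℕ) by norm_num, Real.rpow_natCast, Real.rpow_natCast]
    push_cast
    linarith
  have h73 : x * ((1 - x) / (1 / 2)) ^ (7 / 3 : ℝ) +
      (1 - x) * ((1 / 2 - x) / (1 / 2)) ^ (7 / 3 : ℝ) + 0 * (0 : ℝ) ^ (7 / 3 : ℝ) ≤ 1 := by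
    have e₁ := rpow_seven_thirds_le (t := (1 - x) / (1 / 2)) (by positivity)
    have e₂ := rpow_seven_thirds_le (t := (1 / 2 - x) / (1 / 2)) (by positivity)
    rw [zero_mul, add_zero]
    refine (add_le_add (mul_le_mul_of_nonneg_left e₁ hx)
      (mul_le_mul_of_nonneg_left e₂ h1x)).trans ?_
    nlinarith [mul_nonneg hx (sq_nonneg (1 / 2 - x)), mul_nonneg (sq_nonneg x) h2x, pow_nonneg hx 3]
  have key := sum_rpow_le_of_endpoints hx h1x le_rfl (by positivity) (by positivity) le_rfl
    (by norm_num) (by norm_num) hα hα1 h2 h73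
  rw [Real.div_rpow h1x (by norm_num), Real.div_rpow h2x (by norm_num), zero_mul, add_zero] at key
  have hD : 0 < (1 / 2 : ℝ) ^ α := by positivity
  rw [← mul_le_mul_iff_left₀ hD] at key
  refine le_trans (le_of_eq ?_) (key.trans (le_of_eq (one_mul _)))
  linear_combination -x * div_mul_cancel₀ ((1 - x) ^ α) hD.ne' -
    (1 - x) * div_mul_cancel₀ ((1 / 2 - x) ^ α) hD.ne'

theorem two_point_le_sixPointValue (hα : 7 / 3 ≤ α) (hα1 : α ≤ 4) (hx : 0 ≤ x)
    (hx1 : x ≤ 1 / 2) :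
    x * (1 - x) ^ α + (1 - x) * (1 / 2 - x) ^ α ≤ sixPointValue α (1 / 4) := by
  have h1x : 0 ≤ 1 - x := by linarith
  have h2x : 0 ≤ 1 / 2 - x := by linarith
  have h73 : x * ((1 - x) / (3 / 4)) ^ (7 / 3 : ℝ) +
      (1 - x) * ((1 / 2 - x) / (3 / 4)) ^ (7 / 3 : ℝ) + 0 * (0 : ℝ) ^ (7 / 3 : ℝ) ≤ 2 / 5 := by
    have e₁ := rpow_seven_thirds_le (t := (1 - x) / (3 / 4)) (by positivity)
    have e₂ := rpow_seven_thirds_le (t := (1 / 2 - x) / (3 / 4)) (by positivity)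
    rw [zero_mul, add_zero]
    refine (add_le_add (mul_le_mul_of_nonneg_left e₁ hx)
      (mul_le_mul_of_nonneg_left e₂ h1x)).trans ?_
    nlinarith [mul_nonneg hx (sq_nonneg (1 / 2 - x)), mul_nonneg (sq_nonneg x) h2x,
      pow_nonneg hx 3, pow_nonneg h2x 3]
  have h3 : x * ((1 - x) / (3 / 4)) ^ (3 : ℝ) +
      (1 - x) * ((1 / 2 - x) / (3 / 4)) ^ (3 : ℝ) + 0 * (0 : ℝ) ^ (3 : ℝ) ≤ 2 / 5 := by
    rw [show (3 : ℝ) = (3 : ℕ) by norm_num, Real.rpow_natCast, Real.rpow_natCast]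
    push_cast
    rw [zero_mul, add_zero]
    nlinarith [mul_nonneg hx (sq_nonneg (1 / 2 - x)), mul_nonneg (sq_nonneg x) h2x,
      pow_nonneg hx 3, pow_nonneg h2x 3]
  have h4 : x * ((1 - x) / (3 / 4)) ^ (4 : ℝ) +
      (1 - x) * ((1 / 2 - x) / (3 / 4)) ^ (4 : ℝ) + 0 * (0 : ℝ) ^ (4 : ℝ) ≤ 2 / 5 := by
    rw [show (4 : ℝ) = (4 : ℕ) by norm_num, Real.rpow_natCast, Real.rpow_natCast]
    push_cast
    rw [zero_mul, add_zero]
    nlinarith [mul_nonneg hx (pow_nonneg h2x 3), mul_nonneg (sq_nonneg x) (sq_nonneg (1 / 2 - x)),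
      mul_nonneg (pow_nonneg hx 3) h2x, pow_nonneg hx 4, pow_nonneg h2x 4]
  have key : x * ((1 - x) / (3 / 4)) ^ α + (1 - x) * ((1 / 2 - x) / (3 / 4)) ^ α +
      0 * (0 : ℝ) ^ α ≤ 2 / 5 := by
    rcases le_total α 3 with h | h
    · exact sum_rpow_le_of_endpoints hx h1x le_rfl (by positivity) (by positivity) le_rfl
        (by norm_num) (by norm_num) hα h h73 h3
    · exact sum_rpow_le_of_endpoints hx h1x le_rfl (by positivity) (by positivity) le_rfl
        (by norm_num) (by norm_num) h hα1 h3 h4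
  rw [Real.div_rpow h1x (by norm_num), Real.div_rpow h2x (by norm_num), zero_mul, add_zero] at key
  have hD : 0 < (3 / 4 : ℝ) ^ α := by positivity
  rw [← mul_le_mul_iff_left₀ hD] at key
  have hval : sixPointValue α (1 / 4) = 2 / 5 * (3 / 4) ^ α := by
    unfold sixPointValue; norm_num
  rw [hval]
  refine le_trans (le_of_eq ?_) key
  linear_combination -x * div_mul_cancel₀ ((1 - x) ^ α) hD.ne' -
    (1 - x) * div_mul_cancel₀ ((1 / 2 - x) ^ α) hD.ne'

end TwoPoint

/-- Partial sums of the series of the area hyperbolic tangent enclose a logarithm. -/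
theorem log_mem_Icc_of_artanh {q x lo hi : ℝ} (n : ℕ) (hx0 : 0 ≤ x) (hx1 : x < 1)
    (hq : q = (1 + x) / (1 - x))
    (hlo : lo ≤ 2 * ∑ i ∈ Finset.range n, x ^ (2 * i + 1) / (2 * (i : ℝ) + 1) -
      2 * (x ^ (2 * n + 1) / (1 - x ^ 2)))
    (hhi : 2 * ∑ i ∈ Finset.range n, x ^ (2 * i + 1) / (2 * (i : ℝ) + 1) +
      2 * (x ^ (2 * n + 1) / (1 - x ^ 2)) ≤ hi) :
    lo ≤ Real.log q ∧ Real.log q ≤ hi := by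
  have h := Real.sum_range_sub_log_div_le (x := x) (by rwa [abs_of_nonneg hx0]) n
  rw [abs_of_nonneg hx0, ← hq, abs_le] at h
  constructor <;> linarith [h.1, h.2]

theorem log_three_mem : 1.09 ≤ Real.log 3 ∧ Real.log 3 ≤ 1.1 :=
  log_mem_Icc_of_artanh (x := 1 / 2) 5 (by norm_num) (by norm_num) (by norm_num)
    (by norm_num [Finset.sum_range_succ]) (by norm_num [Finset.sum_range_succ])

theorem log_four_thirds_le : Real.log (4 / 3) ≤ 0.29 :=
  (log_mem_Icc_of_artanh (x := 1 / 7) (lo := 0) 2 (by norm_num) (by norm_num) (by norm_num)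
    (by norm_num [Finset.sum_range_succ]) (by norm_num [Finset.sum_range_succ])).2

theorem log_five_halves_le : Real.log (5 / 2) ≤ 0.92 :=
  (log_mem_Icc_of_artanh (x := 3 / 7) (lo := 0) 4 (by norm_num) (by norm_num) (by norm_num)
    (by norm_num [Finset.sum_range_succ]) (by norm_num [Finset.sum_range_succ])).2

theorem log_eleven_ninths_le : Real.log (11 / 9) ≤ 0.2008 :=
  (log_mem_Icc_of_artanh (x := 1 / 10) (lo := 0) 3 (by norm_num) (by norm_num) (by norm_num)
    (by norm_num [Finset.sum_range_succ]) (by norm_num [Finset.sum_range_succ])).2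

theorem log_thirteen_fourths_le : Real.log (13 / 4) ≤ 1.18 :=
  (log_mem_Icc_of_artanh (x := 9 / 17) (lo := 0) 6 (by norm_num) (by norm_num) (by norm_num)
    (by norm_num [Finset.sum_range_succ]) (by norm_num [Finset.sum_range_succ])).2

/-- A tangent-line bound for `α log (α + 1/2)`. -/
theorem mul_log_add_half_ge {α c : ℝ} (hα : 0 < α) (hc : 0 < c) :
    α * Real.log c + α - c + 1 / 2 - (α + 1 / 2 - c) / (2 * c) ≤ α * Real.log (α + 1 / 2) := by
  have hp : 0 < α + 1 / 2 := by linarith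
  have h := Real.log_le_sub_one_of_pos (div_pos hc hp)
  rw [Real.log_div hc.ne' hp.ne'] at h
  have h2 : α * (Real.log c - Real.log (α + 1 / 2)) ≤ α * (c / (α + 1 / 2) - 1) := by gcongr
  have h3 : α * (c / (α + 1 / 2) - 1) = c - α - c / (2 * (α + 1 / 2)) := by field_simp; ring
  have h4 : 1 - (α + 1 / 2 - c) / c ≤ c / (α + 1 / 2) := by
    rw [le_div_iff₀ hp, one_sub_div hc.ne', div_mul_eq_mul_div, div_le_iff₀ hc]
    nlinarith [sq_nonneg (α + 1 / 2 - c)]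
  have h5 : c / (2 * (α + 1 / 2)) = c / (α + 1 / 2) / 2 := by
    rw [div_div, mul_comm 2]
  have h6 : (α + 1 / 2 - c) / (2 * c) = (α + 1 / 2 - c) / c / 2 := by ring
  rw [h5] at h3
  rw [h6]
  linarith

/-- The slope condition of the threshold certificate with threshold `V ^ (1 / α)`, checked on the
values `V` of two explicit six-point laws. -/
theorem one_le_mul_rpow_sub_one_add {α t V : ℝ} (hα : 9 / 4 ≤ α) (hα4 : α ≤ 4) (ht : 1 / 2 ≤ t)
    (htV : t ^ α = V) (h1 : sixPointValue α (1 / 4) ≤ V) (h2 : sixPointValue α (2 / 11) ≤ V) :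
    1 ≤ α * t ^ (α - 1) + V := by
  have ht0 : 0 < t := by linarith
  have hlogV : α * Real.log t = Real.log V := by rw [← htV, Real.log_rpow ht0]
  -- `α` times the logarithm of `1 ≤ (α + 1/2) t ^ (α - 1)`, which suffices since `V = t t ^ (α - 1)` and
  -- `1/2 ≤ t`
  have key : 0 ≤ (α - 1) * Real.log V + α * Real.log (α + 1 / 2) := by
    rcases le_total α 3 with h | h
    · have hv : Real.log (2 / 5) + α * Real.log (3 / 4) ≤ Real.log V := by
        rw [← Real.log_rpow (by norm_num), ← Real.log_mul (by norm_num) (by positivity)]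
        refine Real.log_le_log (by positivity) (le_trans (le_of_eq ?_) h1)
        unfold sixPointValue; norm_num
      rw [show (2 / 5 : ℝ) = (5 / 2)⁻¹ by norm_num, show (3 / 4 : ℝ) = (4 / 3)⁻¹ by norm_num,
        Real.log_inv, Real.log_inv] at hv
      have hv' : -0.92 - α * 0.29 ≤ Real.log V := by
        nlinarith [log_five_halves_le, log_four_thirds_le]
      have hl := mul_log_add_half_ge (α := α) (c := 3) (by linarith) (by norm_num)
      have h3 : α * 1.09 ≤ α * Real.log 3 := by
        have := log_three_mem.1; gcongr
      have hm : (α - 1) * (-0.92 - α * 0.29) ≤ (α - 1) * Real.log V := by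
        have : 0 ≤ α - 1 := by linarith
        gcongr
      nlinarith
    · have hv : Real.log (4 / 13) + α * Real.log (9 / 11) ≤ Real.log V := by
        rw [← Real.log_rpow (by norm_num), ← Real.log_mul (by norm_num) (by positivity)]
        refine Real.log_le_log (by positivity) (le_trans (le_of_eq ?_) h2)
        unfold sixPointValue; norm_num
      rw [show (4 / 13 : ℝ) = (13 / 4)⁻¹ by norm_num, show (9 / 11 : ℝ) = (11 / 9)⁻¹ by norm_num,
        Real.log_inv, Real.log_inv] at hv
      have hv' : -1.18 - α * 0.2008 ≤ Real.log V := by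
        nlinarith [log_thirteen_fourths_le, log_eleven_ninths_le]
      have hl := mul_log_add_half_ge (α := α) (c := 4) (by linarith) (by norm_num)
      have h3 : α * 1.386 ≤ α * Real.log 4 := by
        have h4 : Real.log 4 = 2 * Real.log 2 := by
          rw [show (4 : ℝ) = 2 ^ (2 : ℕ) by norm_num, Real.log_pow]; norm_num
        have := Real.log_two_gt_d9
        rw [h4]
        gcongr
        linarith
      have hm : (α - 1) * (-1.18 - α * 0.2008) ≤ (α - 1) * Real.log V := by
        have : 0 ≤ α - 1 := by linarith
        gcongr
      nlinarith
  have h3 : 1 ≤ (α + 1 / 2) * t ^ (α - 1) := by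
    rw [← Real.log_nonneg_iff (by positivity), Real.log_mul (by positivity) (by positivity),
      Real.log_rpow ht0]
    have : α * (Real.log (α + 1 / 2) + (α - 1) * Real.log t) =
        (α - 1) * Real.log V + α * Real.log (α + 1 / 2) := by rw [← hlogV]; ring
    exact nonneg_of_mul_nonneg_right (by rw [this]; exact key) (by linarith)
  have h4 : V = t * t ^ (α - 1) := by
    rw [← htV, Real.rpow_sub_one ht0.ne']; field_simp
  have h5 : 0 ≤ t ^ (α - 1) := by positivity
  rw [h4]
  nlinarith

/-- Regime of moderate exponents: the certificate with threshold `t ^ α = V`. -/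
theorem IsCoherent.absDiffMoment_le_of_le_four {p : ℝ} {μ : Measure (ℝ × ℝ)}
    (hμ : IsCoherent.{u} p μ) {α V : ℝ} (hα : 9 / 4 ≤ α) (hα4 : α ≤ 4) (hV1 : V ≤ 1)
    (hV : (1 / 2 : ℝ) ^ α ≤ V) (hVz : ∀ z, 0 ≤ z → z < 1 → sixPointValue α z ≤ V) :
    absDiffMoment α μ ≤ V := by
  have hα0 : 0 < α := by linarith
  have hV0 : 0 < V := lt_of_lt_of_le (by positivity) hV
  set t := V ^ (1 / α) with ht
  have ht0 : 0 ≤ t := by positivity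
  have htV : t ^ α = V := by
    rw [ht, ← Real.rpow_mul hV0.le, one_div_mul_cancel hα0.ne', Real.rpow_one]
  have htl : 1 / 2 ≤ t := by
    rw [← htV] at hV
    exact (Real.rpow_le_rpow_iff (by norm_num) ht0 hα0).1 hV
  have ht1 : t ≤ 1 := Real.rpow_le_one hV0.le hV1 (by positivity)
  refine hμ.absDiffMoment_le_of_threshold (t := t) (by linarith) htl ht1 hV htV.ge
    (one_le_mul_rpow_sub_one_add hα hα4 htl htV (hVz _ (by norm_num) (by norm_num))
      (hVz _ (by norm_num) (by norm_num))) (Or.inl htV.symm) ?_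
  intro x y hx hxy hy
  have h1x : 0 < 1 - x := by linarith
  have h1y : 0 < 1 - y := by linarith
  have hhalf : (y - x) ^ α ≤ (1 / 2 - x) ^ α :=
    Real.rpow_le_rpow (by linarith) (by linarith) hα0.le
  unfold thresholdCert
  rw [htV]
  rcases le_total V ((1 - y) ^ α) with h | h
  · have hyx : (1 - y) ^ α ≤ (1 - x) ^ α := Real.rpow_le_rpow h1y.le (by linarith) hα0.le
    rw [max_eq_right h, max_eq_right (h.trans hyx)]
    have key : x * (1 - y) * (1 - x) ^ α + y * (1 - x) * (1 - y) ^ α +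
        (1 - x) * (1 - y) * (y - x) ^ α ≤ V * (1 - x * y) := by
      have hxy1 : 0 ≤ 1 - x * y := by nlinarith
      by_cases hc : 7 / 3 ≤ α ∨ 1 / 25 ≤ x
      · exact (three_point_le_sixPointValue hα hα4 hx hxy hy hc).trans
          (mul_le_mul_of_nonneg_right (hVz _ (by linarith) (by linarith)) hxy1)
      · rw [not_or, not_le, not_le] at hc
        exact (three_point_le_half_rpow (by linarith) hc.1.le hx hc.2.le hxy hy).trans
          (mul_le_mul_of_nonneg_right hV hxy1)
    have e : V - x * (((1 - x) ^ α - V) / (1 - x)) - y * (((1 - y) ^ α - V) / (1 - y)) =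
        (V * (1 - x * y) - x * (1 - y) * (1 - x) ^ α - y * (1 - x) * (1 - y) ^ α) /
          ((1 - x) * (1 - y)) := by
      field_simp
      ring
    rw [e, le_div_iff₀ (by positivity)]
    linarith
  · rw [max_eq_left h, sub_self, zero_div, mul_zero, sub_zero]
    have key : x * (1 - x) ^ α + (1 - x) * (1 / 2 - x) ^ α ≤ V := by
      rcases le_total α (7 / 3) with h' | h'
      · exact (two_point_le_half_rpow (by linarith) h' hx (by linarith)).trans hV
      · exact (two_point_le_sixPointValue h' hα4 hx (by linarith)).trans
          (hVz _ (by norm_num) (by norm_num))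
    rcases le_total V ((1 - x) ^ α) with h' | h'
    · rw [max_eq_right h']
      have e : V - x * (((1 - x) ^ α - V) / (1 - x)) = (V - x * (1 - x) ^ α) / (1 - x) := by
        field_simp
        ring
      rw [e, le_div_iff₀ h1x]
      nlinarith
    · rw [max_eq_left h', sub_self, zero_div, mul_zero, sub_zero]
      refine le_trans ?_ hV
      exact Real.rpow_le_rpow (by linarith) (by linarith) hα0.le

/-! ### Exponents at least `4` -/

/-- Quadratic lower bound for the margin near the optimal parameter. -/
theorem sq_le_one_sub_one_sub_mul_exp {r : ℝ} (hr : -1.1 ≤ r) (hr1 : r ≤ 1) :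
    0.23 * r ^ 2 ≤ 1 - (1 - r) * Real.exp r := by
  have hE := Real.exp_pos r
  have hEE : Real.exp r * Real.exp (-r) = 1 := by rw [← Real.exp_add]; simp
  have key : 1 - r ≤ (1 - 0.23 * r ^ 2) * Real.exp (-r) := by
    have hr2 : r ^ 2 ≤ 1.21 := by nlinarith
    rcases le_total 0 r with h | h
    · have h1 := Real.add_one_le_exp (-r / 2)
      have h2 : Real.exp (-r) = Real.exp (-r / 2) ^ 2 := by
        rw [← Real.exp_nat_mul]; congr 1; push_cast; ring
      have h3 : (1 - r / 2) ^ 2 ≤ Real.exp (-r) := by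
        rw [h2]; exact pow_le_pow_left₀ (by linarith) (by linarith) 2
      have h4 := mul_le_mul_of_nonneg_left h3 (show (0 : ℝ) ≤ 1 - 0.23 * r ^ 2 by linarith)
      nlinarith [sq_nonneg r, mul_nonneg (sq_nonneg r) h,
        mul_nonneg (mul_nonneg (sq_nonneg r) h) (sub_nonneg.2 hr1)]
    · obtain ⟨s, rfl⟩ : ∃ s, r = -s := ⟨-r, by ring⟩
      have hs : 0 ≤ s := by linarith
      have hs1 : s ≤ 1.1 := by linarith
      have h1 := Real.sum_le_exp_of_nonneg hs 4
      norm_num [Finset.sum_range_succ, Nat.factorial] at h1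
      have h4 := mul_le_mul_of_nonneg_left h1 (show (0 : ℝ) ≤ 1 - 0.23 * s ^ 2 by nlinarith)
      rw [neg_neg, neg_sq]
      refine le_trans ?_ h4
      have h5 : 0 ≤ 0.27 - 0.0634 * s - 0.115 * s ^ 2 - 0.0384 * s ^ 3 := by
        have h6 : s ^ 2 ≤ 1.1 * s := by nlinarith
        have h7 : s ^ 3 ≤ 1.21 * s := by nlinarith
        nlinarith
      nlinarith [mul_nonneg (sq_nonneg s) h5, pow_nonneg hs 3, pow_nonneg hs 5]
  nlinarith [mul_le_mul_of_nonneg_right key hE.le]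

/-- Uniform lower bound for the margin away from the optimal parameter. -/
theorem le_one_sub_one_sub_mul_exp {r : ℝ} (hr : r ≤ -1.1) :
    0.28 ≤ 1 - (1 - r) * Real.exp r := by
  have h1 := Real.sum_le_exp_of_nonneg (show (0 : ℝ) ≤ 1.1 by norm_num) 5
  norm_num [Finset.sum_range_succ, Nat.factorial] at h1
  have h2 := Real.add_one_le_exp (-r - 1.1)
  have h3 : 2.9167 * (-r - 1.1 + 1) ≤ Real.exp (-r) := by
    rw [show -r = 11 / 10 + (-r - 1.1) by norm_num, Real.exp_add]
    refine mul_le_mul (by linarith) (by norm_num at h2 ⊢; linarith) (by linarith) (by positivity)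
  have hEE : Real.exp r * Real.exp (-r) = 1 := by rw [← Real.exp_add]; simp
  have h4 : 1 - r ≤ 0.72 * Real.exp (-r) := by linarith
  nlinarith [mul_le_mul_of_nonneg_right h4 (Real.exp_pos r).le]

theorem one_sub_one_sub_mul_exp_nonneg (r : ℝ) : 0 ≤ 1 - (1 - r) * Real.exp r := by
  have hEE : Real.exp r * Real.exp (-r) = 1 := by rw [← Real.exp_add]; simp
  have h := Real.add_one_le_exp (-r)
  nlinarith [mul_le_mul_of_nonneg_right h (Real.exp_pos r).le]

theorem mul_exp_sub_one_nonneg (r : ℝ) : 0 ≤ r * (Real.exp r - 1) := by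
  rcases le_total 0 r with h | h
  · exact mul_nonneg h (by linarith [Real.one_le_exp h])
  · exact mul_nonneg_of_nonpos_of_nonpos h (by linarith [Real.exp_le_one_iff.2 h])

/-- The margin left at `y` by the certificate pays for the distance `y - x ≤ 1 / 2 - x`; here
`r = (a - x) / (a (1 + a))` is the rescaled distance of `x` to the optimal parameter. -/
theorem mul_exp_two_mul_sub_le {a r : ℝ} (ha : 0 ≤ a) (ha1 : a ≤ 0.176) (hr : 0 ≤ r) (hr1 : r ≤ 1) :
    3 / 8 * Real.exp (2 * r - 1 / (1 + a)) ≤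
      1 - (1 - r) * Real.exp r + a * (r * (Real.exp r - 1)) + 0.28 / (1 + a) := by
  set E := Real.exp r with hE
  have hEr : 1 + r ≤ E := by linarith [Real.add_one_le_exp r]
  set q := a / (1 + a) with hq
  have hq0 : 0 ≤ q := by positivity
  have hq1 : q ≤ 0.15 := by rw [hq, div_le_iff₀ (by linarith)]; linarith
  have hqa : q ≤ a := div_le_self ha (by linarith)
  have hinv : 1 / (1 + a) = 1 - q := by rw [hq]; field_simp; ring
  have hU : E ≤ 1 + r + r ^ 2 / 2 + 2 / 9 * r ^ 3 := by
    have := Real.exp_bound' hr hr1 (n := 3) (by norm_num)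
    norm_num [Finset.sum_range_succ, Nat.factorial] at this
    linarith
  set U := 1 + r + r ^ 2 / 2 + 2 / 9 * r ^ 3 with hUdef
  have he1 : Real.exp (-1) ≤ 0.368 := by
    rw [Real.exp_neg, inv_le_comm₀ (Real.exp_pos _) (by norm_num)]
    have := Real.exp_one_gt_d9
    norm_num at this ⊢; linarith
  have heq : Real.exp q ≤ 1 + 1.15 * q := by
    have := Real.exp_bound' hq0 (by linarith) (n := 2) (by norm_num)
    norm_num [Finset.sum_range_succ, Nat.factorial] at this
    nlinarith
  have hexp : 3 / 8 * Real.exp (2 * r - (1 - q)) ≤ 0.138 * E ^ 2 * (1 + 1.15 * q) := by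
    rw [show 2 * r - (1 - q) = r + r + -1 + q by ring, Real.exp_add, Real.exp_add, Real.exp_add,
      ← hE]
    have hEE : 0 ≤ E * E := by positivity
    have := mul_le_mul (mul_le_mul_of_nonneg_left he1 hEE) heq (Real.exp_pos q).le (by positivity)
    nlinarith
  have hX : 0 ≤ r * (E - 1) := mul_exp_sub_one_nonneg r
  have hqX := mul_le_mul_of_nonneg_right hqa hX
  have h28 : 0.28 / (1 + a) = 0.28 * (1 - q) := by rw [← hinv]; ring
  rw [hinv, h28]
  refine hexp.trans ?_
  -- the inequality is affine in `q`, so the two ends `q = 0` and `q = 0.15` suffice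
  have hF : 0.138 * U ^ 2 * (1 + 1.15 * q) ≤
      1 - (1 - r) * U + q * (r * (U - 1)) + 0.28 * (1 - q) := by
    -- both polynomials have positive Bernstein coefficients, the second one on each half of `[0, 1]`
    have hr' : 0 ≤ 1 - r := by linarith
    have hA : 0 ≤ 1 - (1 - r) * U + 0.28 - 0.138 * U ^ 2 := by
      rw [hUdef]
      linarith [mul_nonneg (pow_nonneg hr 0) (pow_nonneg hr' 6),
        mul_nonneg (pow_nonneg hr 1) (pow_nonneg hr' 5),
        mul_nonneg (pow_nonneg hr 2) (pow_nonneg hr' 4),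
        mul_nonneg (pow_nonneg hr 3) (pow_nonneg hr' 3),
        mul_nonneg (pow_nonneg hr 4) (pow_nonneg hr' 2),
        mul_nonneg (pow_nonneg hr 5) (pow_nonneg hr' 1),
        mul_nonneg (pow_nonneg hr 6) (pow_nonneg hr' 0)]
    have hB : 0 ≤ 1 - (1 - r) * U + 0.15 * (r * (U - 1)) + 0.28 * 0.85 -
        0.138 * 1.1725 * U ^ 2 := by
      rw [hUdef]
      rcases le_total r (1 / 2) with h | h
      · have h' : 0 ≤ 1 / 2 - r := by linarith
        linarith [mul_nonneg (pow_nonneg hr 0) (pow_nonneg h' 6),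
        mul_nonneg (pow_nonneg hr 1) (pow_nonneg h' 5),
        mul_nonneg (pow_nonneg hr 2) (pow_nonneg h' 4),
        mul_nonneg (pow_nonneg hr 3) (pow_nonneg h' 3),
        mul_nonneg (pow_nonneg hr 4) (pow_nonneg h' 2),
        mul_nonneg (pow_nonneg hr 5) (pow_nonneg h' 1),
        mul_nonneg (pow_nonneg hr 6) (pow_nonneg h' 0)]
      · have h' : 0 ≤ r - 1 / 2 := by linarith
        linarith [mul_nonneg (pow_nonneg h' 0) (pow_nonneg hr' 6),
        mul_nonneg (pow_nonneg h' 1) (pow_nonneg hr' 5),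
        mul_nonneg (pow_nonneg h' 2) (pow_nonneg hr' 4),
        mul_nonneg (pow_nonneg h' 3) (pow_nonneg hr' 3),
        mul_nonneg (pow_nonneg h' 4) (pow_nonneg hr' 2),
        mul_nonneg (pow_nonneg h' 5) (pow_nonneg hr' 1),
        mul_nonneg (pow_nonneg h' 6) (pow_nonneg hr' 0)]
    nlinarith [mul_nonneg hq0 hB, mul_nonneg (sub_nonneg.2 hq1) hA]
  -- the difference of the two sides is monotone in `E`, so `E` may be replaced by `U`
  have hEU : 0 ≤ (U - E) * ((1 - r) - q * r + 0.138 * (1 + 1.15 * q) * (U + E)) := by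
    refine mul_nonneg (by linarith) ?_
    have : q * r ≤ 0.15 * 1 := mul_le_mul hq1 hr1 hr (by norm_num)
    have h2 : 0.138 * (U + E) ≤ 0.138 * (1 + 1.15 * q) * (U + E) :=
      mul_le_mul_of_nonneg_right (by linarith) (by linarith)
    linarith
  nlinarith

namespace IsOptimalParam

variable {α a : ℝ}

theorem div_one_sub_eq (h : IsOptimalParam α a) : α / (1 - a) = 1 / (a * (1 + a)) := by
  have h0 := h.pos
  have h1 : 0 < 1 - a := by linarith [h.lt_one]
  rw [div_eq_div_iff h1.ne' (by positivity)]
  linarith [h.eq]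

theorem le_of_four_le (h : IsOptimalParam α a) (hα : 4 ≤ α) : a ≤ 0.176 := by
  have h0 := h.pos
  have h1 := h.eq
  have : 4 * (a * (1 + a)) ≤ α * (a * (1 + a)) := mul_le_mul_of_nonneg_right hα (by positivity)
  nlinarith

theorem one_le_mul_add_two (h : IsOptimalParam α a) : 1 ≤ a * (α + 2) := by
  have h0 := h.pos
  have h1 := h.eq
  have h2 := h.lt_one
  have : 0 ≤ (1 + a) * (a * (α + 2) - 1) := by nlinarith
  nlinarith [nonneg_of_mul_nonneg_right this (by linarith)]

/-- `log q ≤ q - 1` for `q = (1 - x) / (1 - a)`, rewritten with the equation for `a`. -/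
theorem one_sub_rpow_le (h : IsOptimalParam α a) (hα : 0 < α) {x : ℝ} (hx : x < 1) :
    (1 - x) ^ α ≤ (1 - a) ^ α * Real.exp ((a - x) / (a * (1 + a))) := by
  have h0 := h.pos
  have h1 : 0 < 1 - a := by linarith [h.lt_one]
  have hx' : 0 < 1 - x := by linarith
  have hq : 0 < (1 - x) / (1 - a) := div_pos hx' h1
  have key : ((1 - x) / (1 - a)) ^ α ≤ Real.exp ((a - x) / (a * (1 + a))) := by
    rw [Real.rpow_def_of_pos hq]
    refine Real.exp_le_exp.2 ?_
    have e : (a - x) / (a * (1 + a)) = α * ((1 - x) / (1 - a) - 1) := by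
      rw [div_sub_one h1.ne', div_eq_mul_one_div, ← h.div_one_sub_eq]; ring
    rw [e, mul_comm]
    exact mul_le_mul_of_nonneg_left (Real.log_le_sub_one_of_pos hq) hα.le
  rw [Real.div_rpow hx'.le h1.le, div_le_iff₀ (Real.rpow_pos_of_pos h1 _)] at key
  linarith

theorem half_rpow_le (h : IsOptimalParam α a) (hα : 4 ≤ α) : (1 / 2 : ℝ) ^ α ≤ 3 / 8 * a := by
  have h1 := h.one_le_mul_add_two
  have h0 := h.pos
  have h2 : 8 * (α - 2) ≤ (2 : ℝ) ^ α := by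
    have e : (2 : ℝ) ^ α = 16 * 2 ^ (α - 4) := by
      rw [Real.rpow_sub (by norm_num)]; norm_num
      field_simp
    have e2 : (α - 4) * (1 / 2) + 1 ≤ (2 : ℝ) ^ (α - 4) := by
      rw [Real.rpow_def_of_pos (by norm_num)]
      refine le_trans ?_ (Real.add_one_le_exp _)
      nlinarith [Real.log_two_gt_d9]
    rw [e]; linarith
  rw [one_div, Real.inv_rpow (by norm_num)]
  rw [inv_le_iff_one_le_mul₀ (by positivity)]
  have h3 : 3 / 8 * a * (8 * (α - 2)) ≤ 3 / 8 * a * 2 ^ α :=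
    mul_le_mul_of_nonneg_left h2 (by positivity)
  nlinarith

theorem half_sub_rpow_le (h : IsOptimalParam α a) (hα : 4 ≤ α) {x : ℝ} (hx : x ≤ a) :
    (1 / 2 - x) ^ α ≤ 3 / 8 * Real.exp (2 * ((a - x) / (a * (1 + a))) - 1 / (1 + a)) *
      (a * (1 - a) ^ α) := by
  have h0 := h.pos
  have ha := h.le_of_four_le hα
  have h1 := h.one_sub_rpow_le (by linarith) (x := 2 * x) (by linarith)
  have e : (a - 2 * x) / (a * (1 + a)) = 2 * ((a - x) / (a * (1 + a))) - 1 / (1 + a) := by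
    field_simp; ring
  rw [e] at h1
  have h2 : (1 / 2 - x) ^ α = (1 / 2 : ℝ) ^ α * (1 - 2 * x) ^ α := by
    rw [← Real.mul_rpow (by norm_num) (by linarith)]; congr 1; ring
  rw [h2]
  have h3 := mul_le_mul (h.half_rpow_le hα) h1 (Real.rpow_nonneg (by linarith) _) (by positivity)
  refine h3.trans (le_of_eq ?_)
  ring

/-- What the certificate leaves at `x` when its branch `(1 - x) ^ α` is active. -/
theorem le_half_sub_mul_div (h : IsOptimalParam α a) (hα : 0 < α) {x r : ℝ} (hx : 0 ≤ x)
    (hx1 : x < 1) (hr : r = (a - x) / (a * (1 + a))) :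
    a * (1 - a) ^ α * (1 - (1 - r) * Real.exp r + a * (r * (Real.exp r - 1))) ≤
      sixPointValue α a / 2 - x * (((1 - x) ^ α - sixPointValue α a) / (1 - x)) := by
  have h0 := h.pos
  have h1 : 0 < 1 - a := by linarith [h.lt_one]
  have hx' : 0 < 1 - x := by linarith
  have hxr : x = a - a * (1 + a) * r := by rw [hr]; field_simp; ring
  have hD : 0 < (1 - a) ^ α := Real.rpow_pos_of_pos h1 _
  have hP := h.one_sub_rpow_le hα hx1
  rw [← hr] at hP
  set D := (1 - a) ^ α
  set P := (1 - x) ^ α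
  set E := Real.exp r
  set φ := 1 - (1 - r) * E + a * (r * (E - 1)) with hφ
  have hφ0 : 0 ≤ φ := add_nonneg (one_sub_one_sub_mul_exp_nonneg r)
    (mul_nonneg h0.le (mul_exp_sub_one_nonneg r))
  have hV : sixPointValue α a * (1 + a) = 2 * a * D := by
    unfold sixPointValue; field_simp; rfl
  have hV2 : sixPointValue α a / 2 * (1 + x) = a * D * (1 - a * r) := by
    have : sixPointValue α a / 2 * (1 + x) = sixPointValue α a * (1 + a) / 2 * (1 - a * r) := by
      rw [hxr]; ring
    rw [this, hV]; ring
  have hnum : a * D * φ ≤ sixPointValue α a / 2 * (1 + x) - x * P := by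
    have := mul_le_mul_of_nonneg_left hP hx
    have e : x * (D * E) = a * D * (1 - (1 + a) * r) * E := by rw [hxr]; ring
    rw [hV2, hφ]
    nlinarith
  have e : sixPointValue α a / 2 - x * ((P - sixPointValue α a) / (1 - x)) =
      (sixPointValue α a / 2 * (1 + x) - x * P) / (1 - x) := by field_simp; ring
  rw [e, le_div_iff₀ hx']
  refine le_trans ?_ hnum
  exact mul_le_of_le_one_right (mul_nonneg (by positivity) hφ0) (by linarith)

/-- Two forms of `exp (-1 / (1 + a)) ≤ (1 - a) ^ α`, with rational bounds for `exp 1`. -/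
theorem exp_neg_le_one_sub_rpow (h : IsOptimalParam α a) (hα : 0 < α) :
    0.3678 * ((1 + 2 * a) / (1 + a)) ≤ (1 - a) ^ α ∧ (1 + 2 * a) / (1 + a) ≤ 2.72 * (1 - a) ^ α := by
  have h0 := h.pos
  have h1 := h.one_sub_rpow_le hα (x := 0) (by norm_num)
  rw [sub_zero, Real.one_rpow, sub_zero] at h1
  have e : a / (a * (1 + a)) = 1 + -(a / (1 + a)) := by field_simp; ring
  rw [e, Real.exp_add] at h1
  set q := a / (1 + a) with hq
  have hq2 : (1 + 2 * a) / (1 + a) = 1 + q := by rw [hq]; field_simp; ring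
  rw [hq2]
  have h2 := Real.add_one_le_exp q
  have hEE : Real.exp q * Real.exp (-q) = 1 := by rw [← Real.exp_add]; simp
  have hD : 0 ≤ (1 - a) ^ α := Real.rpow_nonneg (by linarith [h.lt_one]) _
  have h3 : Real.exp q ≤ (1 - a) ^ α * Real.exp 1 := by
    have := mul_le_mul_of_nonneg_left h1 (Real.exp_pos q).le
    calc Real.exp q = Real.exp q * 1 := (mul_one _).symm
      _ ≤ _ := this
      _ = (1 - a) ^ α * Real.exp 1 * (Real.exp q * Real.exp (-q)) := by ring
      _ = _ := by rw [hEE, mul_one]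
  have he := Real.exp_one_lt_d9
  norm_num at he
  constructor
  · have : (1 - a) ^ α * Real.exp 1 ≤ (1 - a) ^ α * 2.7182818286 :=
      mul_le_mul_of_nonneg_left (by norm_num; linarith) hD
    norm_num at this ⊢; linarith
  · have : (1 - a) ^ α * Real.exp 1 ≤ (1 - a) ^ α * 2.72 :=
      mul_le_mul_of_nonneg_left (by norm_num; linarith) hD
    linarith

theorem one_sub_rpow_le_of_four_le (h : IsOptimalParam α a) (hα : 4 ≤ α) :
    (1 - a) ^ α ≤ 0.52 := by
  have h0 := h.pos
  have ha := h.le_of_four_le hα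
  have h1 : 0 < 1 - a := by linarith
  have hαa : α * a = (1 - a) / (1 + a) := by
    rw [eq_div_iff (by linarith)]; linarith [h.eq]
  have h2 : (0.7 : ℝ) ≤ α * a := by rw [hαa, le_div_iff₀ (by linarith)]; linarith
  have h3 : (1 - a) ^ α ≤ Real.exp (-0.7) := by
    rw [Real.rpow_def_of_pos h1]
    refine Real.exp_le_exp.2 ?_
    nlinarith [Real.log_le_sub_one_of_pos h1]
  refine h3.trans ?_
  have h4 := Real.quadratic_le_exp_of_nonneg (show (0 : ℝ) ≤ 0.7 by norm_num)
  rw [Real.exp_neg, inv_le_comm₀ (Real.exp_pos _) (by norm_num)]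
  norm_num at h4 ⊢; linarith

end IsOptimalParam

namespace IsOptimalParam

variable {α a : ℝ}

theorem sixPointValue_mul (h : IsOptimalParam α a) :
    sixPointValue α a * (1 + a) = 2 * (a * (1 - a) ^ α) := by
  have h0 := h.pos
  unfold sixPointValue; field_simp

theorem mul_le_sixPointValue (h : IsOptimalParam α a) (hα : 4 ≤ α) :
    0.71 * a ≤ sixPointValue α a := by
  have h0 := h.pos
  have ha := h.le_of_four_le hα
  have hV := h.sixPointValue_mul
  have hD := (h.exp_neg_le_one_sub_rpow (by linarith)).1
  have e : (1 + 2 * a) / (1 + a) * (1 + a) = 1 + 2 * a := by field_simp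
  have h1 : 0.3678 * (1 + 2 * a) ≤ (1 - a) ^ α * (1 + a) := by
    have := mul_le_mul_of_nonneg_right hD (show 0 ≤ 1 + a by linarith)
    linarith
  have h2 : 0.71 * a * (1 + a) ^ 2 ≤ sixPointValue α a * (1 + a) ^ 2 := by
    have : sixPointValue α a * (1 + a) ^ 2 = 2 * a * ((1 - a) ^ α * (1 + a)) := by
      rw [pow_two, ← mul_assoc, hV]; ring
    rw [this]
    have h3 := mul_le_mul_of_nonneg_left h1 (show 0 ≤ 2 * a by linarith)
    have h4 : 0.71 * (1 + a) ^ 2 ≤ 0.7356 * (1 + 2 * a) := by nlinarith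
    linarith [mul_le_mul_of_nonneg_left h4 h0.le]
  exact le_of_mul_le_mul_right h2 (by positivity)

theorem half_rpow_le_sixPointValue (h : IsOptimalParam α a) (hα : 4 ≤ α) :
    (1 / 2 : ℝ) ^ α ≤ sixPointValue α a := by
  linarith [h.half_rpow_le hα, h.mul_le_sixPointValue hα, h.pos]

theorem div_rpow_le (h : IsOptimalParam α a) (hα : 4 ≤ α) :
    (α / (2 * α - 1)) ^ α ≤ 1.36 * sixPointValue α a := by
  have hp : 0 < 2 * α - 1 := by linarith
  have e : α / (2 * α - 1) = 1 / 2 * (1 + 1 / (2 * α - 1)) := by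
    rw [div_eq_iff hp.ne']
    linear_combination -(1 / 2) * one_div_mul_cancel hp.ne'
  have hq : 0 ≤ 1 / (2 * α - 1) := by positivity
  rw [e, Real.mul_rpow (by norm_num) (by linarith)]
  have h1 : (1 + 1 / (2 * α - 1)) ^ α ≤ 7 / 3 := by
    have h2 : (1 + 1 / (2 * α - 1)) ^ α ≤ Real.exp (4 / 7) := by
      rw [Real.rpow_def_of_pos (by linarith)]
      refine Real.exp_le_exp.2 ?_
      have h3 := Real.log_le_sub_one_of_pos (show 0 < 1 + 1 / (2 * α - 1) by linarith)
      have h4 : 1 / (2 * α - 1) * α ≤ 4 / 7 := by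
        rw [one_div_mul_eq_div, div_le_div_iff₀ hp (by norm_num)]; linarith
      nlinarith
    have h5 := Real.add_one_le_exp (-(4 / 7 : ℝ))
    rw [Real.exp_neg] at h5
    have h6 : (3 / 7 : ℝ) ≤ (Real.exp (4 / 7))⁻¹ := by linarith
    rw [le_inv_comm₀ (by norm_num) (Real.exp_pos _)] at h6
    norm_num at h6
    linarith
  have h0 := h.pos
  have h7 := mul_le_mul (h.half_rpow_le hα) h1 (by positivity) (by positivity)
  linarith [h.mul_le_sixPointValue hα]

theorem sixPointValue_le_of_four_le (h : IsOptimalParam α a) (hα : 4 ≤ α) :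
    sixPointValue α a ≤ 0.157 := by
  have h0 := h.pos
  have ha := h.le_of_four_le hα
  have hV := h.sixPointValue_mul
  have hD := h.one_sub_rpow_le_of_four_le hα
  have : sixPointValue α a * (1 + a) ≤ 0.157 * (1 + a) := by rw [hV]; nlinarith
  exact le_of_mul_le_mul_right this (by linarith)

/-- The slope condition for the threshold `t` with `t ^ α = 1.36 V`. -/
theorem one_le_mul_rpow_sub_one_add (h : IsOptimalParam α a) (hα : 4 ≤ α) {t : ℝ} (ht : 0 < t)
    (htV : t ^ α = 1.36 * sixPointValue α a) : 1 ≤ α * t ^ (α - 1) + sixPointValue α a := by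
  have h0 := h.pos
  have ha := h.le_of_four_le hα
  have hV := h.sixPointValue_mul
  have hV0 : 0 < sixPointValue α a := by
    have := h.mul_le_sixPointValue hα
    linarith
  have hV1 := h.sixPointValue_le_of_four_le hα
  obtain ⟨hD1, hD2⟩ := h.exp_neg_le_one_sub_rpow (by linarith : 0 < α)
  have e : (1 + 2 * a) / (1 + a) * (1 + a) = 1 + 2 * a := by field_simp
  -- `t⁻¹ = exp (-log (1.36 V) / α) ≥ 1 + 1.5 / α`, since `1.36 V ≤ exp (-1.5)`
  have hlog : α * Real.log t ≤ -1.5 := by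
    rw [← Real.log_rpow ht, htV, Real.log_le_iff_le_exp (by positivity), Real.exp_neg]
    have h1 : Real.exp 1.5 ≤ 4.5 := by
      refine le_of_pow_le_pow_left₀ two_ne_zero (by norm_num) ?_
      rw [← Real.exp_nat_mul]
      have h2 : Real.exp ((2 : ℕ) * 1.5) = Real.exp 1 ^ 3 := by
        rw [← Real.exp_nat_mul]; norm_num
      rw [h2]
      have h3 : Real.exp 1 ≤ 2.72 := by
        have := Real.exp_one_lt_d9
        norm_num at this ⊢; linarith
      refine (pow_le_pow_left₀ (Real.exp_pos 1).le h3 3).trans (by norm_num)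
    refine le_trans ?_ (inv_anti₀ (Real.exp_pos _) h1)
    norm_num at hV1 ⊢; linarith
  have hinv : 1 + 1.5 / α ≤ t⁻¹ := by
    rw [← Real.exp_log ht, ← Real.exp_neg]
    refine le_trans ?_ (Real.add_one_le_exp _)
    have : 1.5 / α ≤ -Real.log t := by
      rw [div_le_iff₀ (by linarith)]; linarith
    linarith
  have h1 : (α + 1.5) * (1.36 * sixPointValue α a) ≤ α * t ^ (α - 1) := by
    rw [Real.rpow_sub_one ht.ne', htV, div_eq_mul_inv]
    have h2 := mul_le_mul_of_nonneg_left hinv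
      (show 0 ≤ α * (1.36 * sixPointValue α a) by positivity)
    have h3 : α * (1 + 1.5 / α) = α + 1.5 := by field_simp
    calc (α + 1.5) * (1.36 * sixPointValue α a)
        = α * (1.36 * sixPointValue α a) * (1 + 1.5 / α) := by rw [← h3]; ring
      _ ≤ _ := h2
      _ = _ := by ring
  refine le_trans ?_ (add_le_add_left h1 _)
  have hA : 1 + 2 * a ≤ 2.72 * ((1 - a) ^ α * (1 + a)) := by
    have := mul_le_mul_of_nonneg_right hD2 (show 0 ≤ 1 + a by linarith)
    linarith
  have hB : 0.3678 * (1 + 2 * a) ≤ (1 - a) ^ α * (1 + a) := by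
    have := mul_le_mul_of_nonneg_right hD1 (show 0 ≤ 1 + a by linarith)
    linarith
  set D := (1 - a) ^ α
  set V := sixPointValue α a
  have e1 : α * V * (1 + a) ^ 3 = 2 * (1 - a) * (D * (1 + a)) := by
    calc α * V * (1 + a) ^ 3 = α * (1 + a) ^ 2 * (V * (1 + a)) := by ring
      _ = 2 * (α * (a * (1 + a))) * (D * (1 + a)) := by rw [hV]; ring
      _ = _ := by rw [h.eq]
  have e2 : V * (1 + a) ^ 3 = 2 * a * (1 + a) * (D * (1 + a)) := by
    calc V * (1 + a) ^ 3 = (1 + a) ^ 2 * (V * (1 + a)) := by ring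
      _ = _ := by rw [hV]; ring
  have h5 : 1 * (1 + a) ^ 3 ≤ ((α + 1.5) * (1.36 * V) + V) * (1 + a) ^ 3 := by
    have e3 : ((α + 1.5) * (1.36 * V) + V) * (1 + a) ^ 3 =
        1.36 * (α * V * (1 + a) ^ 3) + 3.04 * (V * (1 + a) ^ 3) := by ring
    rw [e3, e1, e2]
    have h6 := mul_le_mul_of_nonneg_left hA (show 0 ≤ 1 - a by linarith)
    have h7 := mul_le_mul_of_nonneg_left hB (show 0 ≤ a * (1 + a) by positivity)
    nlinarith [pow_nonneg h0.le 3]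
  exact le_of_mul_le_mul_right h5 (by positivity)

/-- Convexity bounds the distance to the power `α` by the distances to `a`, and these are
negligible compared with the quadratic margin of the certificate. -/
theorem sub_rpow_le_of_near (h : IsOptimalParam α a) (hα : 4 ≤ α) {x y r s : ℝ} (hxy : x ≤ y)
    (hr : r = (a - x) / (a * (1 + a))) (hs : s = (a - y) / (a * (1 + a)))
    (hr1 : |r| ≤ 1.1) (hs1 : |s| ≤ 1.1) :
    (y - x) ^ α ≤ a * (1 - a) ^ α * (0.23 * r ^ 2 + 0.23 * s ^ 2) := by
  have h0 := h.pos
  have h1 : 0 < 1 - a := by linarith [h.lt_one]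
  have hx : x = a - a * (1 + a) * r := by rw [hr]; field_simp; ring
  have hy : y = a - a * (1 + a) * s := by rw [hs]; field_simp; ring
  have hα0 : 0 < α := by linarith
  have hone : ∀ u : ℝ, |u| ≤ 1.1 → (2 * (a * (1 + a)) * |u|) ^ α ≤
      2 * (a * (1 - a) ^ α * (0.23 * u ^ 2)) := by
    intro u hu
    have e : 2 * (a * (1 + a)) * |u| = (1 - a) * (2 * |u| / α) := by
      field_simp; linear_combination |u| * h.eq
    have hv0 : 0 ≤ 2 * |u| / α := by positivity
    have hv1 : 2 * |u| / α ≤ 1 := by rw [div_le_one hα0]; linarith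
    rw [e, Real.mul_rpow h1.le hv0]
    have h2 : (2 * |u| / α) ^ α ≤ (2 * |u| / α) ^ 4 := by
      rw [← Real.rpow_natCast]
      exact Real.rpow_le_rpow_of_exponent_ge' hv0 hv1 (by norm_num) (by exact_mod_cast hα)
    have h3 : (2 * |u| / α) ^ 4 ≤ 2 * a * (0.23 * u ^ 2) := by
      rw [div_pow, div_le_iff₀ (by positivity)]
      have h4 : (2 * |u|) ^ 4 = 16 * (u ^ 2 * u ^ 2) := by
        rw [mul_pow, show |u| ^ 4 = (|u| ^ 2) ^ 2 by ring, sq_abs]; ring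
      have h5 : u ^ 2 ≤ 1.21 := by rw [← sq_abs]; nlinarith [abs_nonneg u]
      have h6 : 19.36 ≤ 2 * a * 0.23 * α ^ 4 := by
        have h7 : (4 : ℝ) ^ 3 ≤ α ^ 3 := pow_le_pow_left₀ (by norm_num) hα 3
        have h8 : 4 ^ 3 * α ≤ α ^ 3 * α := mul_le_mul_of_nonneg_right h7 hα0.le
        have h10 : 42.1 * (α + 2) ≤ α ^ 4 := by nlinarith
        have h11 := mul_le_mul_of_nonneg_left h10 h0.le
        have h12 := h.one_le_mul_add_two
        nlinarith
      rw [h4]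
      nlinarith [mul_le_mul_of_nonneg_left h5 (sq_nonneg u),
        mul_le_mul_of_nonneg_left h6 (sq_nonneg u)]
    have hD : 0 ≤ (1 - a) ^ α := Real.rpow_nonneg h1.le _
    have := mul_le_mul_of_nonneg_left (h2.trans h3) hD
    linarith
  have hc := (convexOn_rpow (by linarith : 1 ≤ α)).2
    (show 2 * (a * (1 + a)) * |r| ∈ Set.Ici 0 from Set.mem_Ici.2 (by positivity))
    (show 2 * (a * (1 + a)) * |s| ∈ Set.Ici 0 from Set.mem_Ici.2 (by positivity))
    (show (0 : ℝ) ≤ 1 / 2 by norm_num) (show (0 : ℝ) ≤ 1 / 2 by norm_num) (by norm_num)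
  simp only [smul_eq_mul] at hc
  have h2 : y - x ≤ 1 / 2 * (2 * (a * (1 + a)) * |r|) + 1 / 2 * (2 * (a * (1 + a)) * |s|) := by
    have e : y - x = a * (1 + a) * (r - s) := by rw [hx, hy]; ring
    have : r - s ≤ |r| + |s| := by linarith [le_abs_self r, neg_abs_le s]
    rw [e]
    have := mul_le_mul_of_nonneg_left this (show 0 ≤ a * (1 + a) by positivity)
    linarith
  have h3 := Real.rpow_le_rpow (by linarith) h2 hα0.le
  linarith [hone r hr1, hone s hs1]

end IsOptimalParam

/-- Regime of large exponents: the certificate with threshold `t ^ α = 1.36 V`. -/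
theorem IsCoherent.absDiffMoment_le_of_four_le {α a : ℝ} {μ : Measure (ℝ × ℝ)}
    (hμ : IsCoherent.{u} (1 / 2) μ) (hα : 4 ≤ α) (h : IsOptimalParam α a) :
    absDiffMoment α μ ≤ sixPointValue α a := by
  have hα0 : 0 < α := by linarith
  have h0 := h.pos
  have ha := h.le_of_four_le hα
  have hVlow := h.mul_le_sixPointValue hα
  have hVup := h.sixPointValue_le_of_four_le hα
  have hVmul := h.sixPointValue_mul
  have hV0 : 0 < sixPointValue α a := by linarith
  set t := (1.36 * sixPointValue α a) ^ (1 / α) with ht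
  have htV : t ^ α = 1.36 * sixPointValue α a := by
    rw [ht, ← Real.rpow_mul (by positivity), one_div_mul_cancel hα0.ne', Real.rpow_one]
  have ht0 : 0 < t := by positivity
  have htα : α / (2 * α - 1) ≤ t := by
    rw [← Real.rpow_le_rpow_iff (div_nonneg hα0.le (by linarith)) ht0.le hα0, htV]
    exact h.div_rpow_le hα
  have hthalf : 1 / 2 ≤ t := by
    refine le_trans ?_ htα
    rw [div_le_div_iff₀ (by norm_num) (by linarith)]; linarith
  have ht1 : t ≤ 1 := by
    refine Real.rpow_le_one (by positivity) ?_ (by positivity)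
    norm_num at hVup ⊢; linarith
  have hA := h.one_le_mul_rpow_sub_one_add hα ht0 htV
  have hcase : α ≤ t * (2 * α - 1) := by rwa [div_le_iff₀ (by linarith)] at htα
  refine hμ.absDiffMoment_le_of_threshold (by linarith) hthalf ht1
    (h.half_rpow_le_sixPointValue hα) (by rw [htV]; linarith) hA (Or.inr hcase) ?_
  set V := sixPointValue α a with hV
  set D := (1 - a) ^ α with hD
  have hD0 : 0 < D := Real.rpow_pos_of_pos (by linarith) _
  -- the margin left by the certificate at one point
  obtain ⟨q, hq⟩ : ∃ q : ℝ → ℝ, ∀ x, q x = V / 2 - x * thresholdCert α t V x := ⟨_, fun _ => rfl⟩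
  suffices H : ∀ x y, 0 ≤ x → x ≤ y → y ≤ 1 / 2 → (y - x) ^ α ≤ q x + q y by
    intro x y hx hxy hy
    have := H x y hx hxy hy
    rw [hq, hq] at this
    linarith
  have hpow : ∀ x r, 0 ≤ x → x ≤ 1 / 2 → t ^ α ≤ (1 - x) ^ α → r = (a - x) / (a * (1 + a)) →
      a * D * (1 - (1 - r) * Real.exp r + a * (r * (Real.exp r - 1))) ≤ q x := by
    intro x r hx hx1 hb hr
    rw [hq, thresholdCert, max_eq_right hb]
    exact h.le_half_sub_mul_div hα0 hx (by linarith) hr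
  have hfar0 : 0.28 * (a * D) = 0.14 * V * (1 + a) := by rw [mul_assoc, hVmul]; ring
  have hfar : ∀ x, 0 ≤ x → x ≤ 1 / 2 →
      0.14 * V ≤ q x ∨ (-1.1 ≤ (a - x) / (a * (1 + a)) ∧ t ^ α ≤ (1 - x) ^ α) := by
    intro x hx hx1
    rcases le_total (t ^ α) ((1 - x) ^ α) with hb | hb
    · rcases le_total (-1.1) ((a - x) / (a * (1 + a))) with hr | hr
      · exact Or.inr ⟨hr, hb⟩
      · left
        refine le_trans ?_ (hpow x _ hx hx1 hb rfl)
        have h1 := le_one_sub_one_sub_mul_exp hr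
        have h2 := mul_nonneg h0.le (mul_exp_sub_one_nonneg ((a - x) / (a * (1 + a))))
        have h3 := mul_le_mul_of_nonneg_left (add_le_add h1 h2)
          (show 0 ≤ a * D by positivity)
        have h4 : 0 ≤ V * a := by positivity
        linarith
    · left
      rw [hq, thresholdCert, max_eq_left hb, htV]
      have : x * ((1.36 * V - V) / (1 - x)) ≤ 0.36 * V := by
        rw [mul_div_assoc', div_le_iff₀ (by linarith)]
        nlinarith
      linarith
  have hq0 : ∀ x, 0 ≤ x → x ≤ 1 / 2 → 0 ≤ q x := by
    intro x hx hx1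
    rcases hfar x hx hx1 with h1 | ⟨-, hb⟩
    · refine le_trans ?_ h1; positivity
    · exact (mul_nonneg (by positivity) (add_nonneg (one_sub_one_sub_mul_exp_nonneg _)
        (mul_nonneg h0.le (mul_exp_sub_one_nonneg _)))).trans (hpow x _ hx hx1 hb rfl)
  have hinv : a * D * (0.28 / (1 + a)) = 0.14 * V := by
    rw [mul_div_assoc', div_eq_iff (by linarith)]; linarith
  have htD : t ^ α ≤ D := by
    rw [htV]
    have : 1.36 * V * (1 + a) ≤ D * (1 + a) := by
      rw [mul_assoc, hVmul]; nlinarith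
    exact le_of_mul_le_mul_right this (by linarith)
  intro x y hx hxy hy
  have hrle : ∀ z, 0 ≤ z → (a - z) / (a * (1 + a)) ≤ 1 := fun z hz => by
    rw [div_le_one (by positivity)]; nlinarith
  rcases hfar y (by linarith) hy with h1 | ⟨hs, hb⟩
  · rcases le_total x a with hxa | hxa
    · set r := (a - x) / (a * (1 + a)) with hr
      have hr0 : 0 ≤ r := div_nonneg (by linarith) (by positivity)
      have h2 := h.half_sub_rpow_le hα hxa
      rw [← hr] at h2
      have h3 := mul_exp_two_mul_sub_le h0.le ha hr0 (hrle x hx)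
      have h4 := mul_le_mul_of_nonneg_right h3 (show 0 ≤ a * D by positivity)
      have h5 := hpow x r hx (by linarith)
        (htD.trans (Real.rpow_le_rpow (by linarith) (by linarith) hα0.le)) hr
      have h6 : (y - x) ^ α ≤ (1 / 2 - x) ^ α :=
        Real.rpow_le_rpow (by linarith) (by linarith) hα0.le
      linarith
    · have h2 := h.half_sub_rpow_le hα le_rfl
      have h3 := mul_exp_two_mul_sub_le h0.le ha le_rfl zero_le_one
      rw [sub_self, zero_div] at h2
      have h4 := mul_le_mul_of_nonneg_right h3 (show 0 ≤ a * D by positivity)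
      have h6 : (y - x) ^ α ≤ (1 / 2 - a) ^ α :=
        Real.rpow_le_rpow (by linarith) (by linarith) hα0.le
      have h7 : 1 - (1 - 0) * Real.exp 0 + a * (0 * (Real.exp 0 - 1)) = 0 := by simp
      rw [h7] at h4
      linarith [hq0 x hx (by linarith)]
  · have hbx : t ^ α ≤ (1 - x) ^ α :=
      hb.trans (Real.rpow_le_rpow (by linarith) (by linarith) hα0.le)
    have hrs : (a - y) / (a * (1 + a)) ≤ (a - x) / (a * (1 + a)) :=
      div_le_div_of_nonneg_right (by linarith) (by positivity)
    have hr1 := hrle x hx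
    have hs1 := hrle y (by linarith)
    have hqx := hpow x _ hx (by linarith) hbx rfl
    have hqy := hpow y _ (by linarith) hy hb rfl
    have hn := h.sub_rpow_le_of_near hα hxy rfl rfl (abs_le.2 ⟨by linarith, by linarith⟩)
      (abs_le.2 ⟨by linarith, by linarith⟩)
    set r := (a - x) / (a * (1 + a))
    set s := (a - y) / (a * (1 + a))
    have hx2 := add_le_add (sq_le_one_sub_one_sub_mul_exp (hs.trans hrs) hr1)
      (mul_nonneg h0.le (mul_exp_sub_one_nonneg r))
    have hy2 := add_le_add (sq_le_one_sub_one_sub_mul_exp hs hs1)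
      (mul_nonneg h0.le (mul_exp_sub_one_nonneg s))
    have := mul_le_mul_of_nonneg_left (add_le_add hx2 hy2) (show 0 ≤ a * D by positivity)
    linarith

/-! ### The critical exponent and the small exponents -/

theorem IsOptimalParam.two_mul_div_lt_one {α a : ℝ} (h : IsOptimalParam α a) :
    2 * a / (1 + a) < 1 := by
  rw [div_lt_one (by linarith [h.pos])]; linarith [h.lt_one]

theorem sixPointValue_eq_mul_half_rpow {α z : ℝ} (hz : z ≤ 1) :
    sixPointValue α z = 2 * z / (1 + z) * (2 * (1 - z)) ^ α * (1 / 2) ^ α := by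
  unfold sixPointValue
  rw [mul_assoc, ← Real.mul_rpow (by linarith) (by norm_num)]
  congr 2; ring

theorem IsOptimalParam.lt_half_of_half_rpow_le {α a : ℝ} (h : IsOptimalParam α a) (hα : 0 < α)
    (hV : (1 / 2 : ℝ) ^ α ≤ sixPointValue α a) : a < 1 / 2 := by
  by_contra hcon
  have h1 := h.lt_one
  have h2 : (2 * (1 - a)) ^ α ≤ 1 := Real.rpow_le_one (by linarith) (by linarith) hα.le
  have hp : (0 : ℝ) < (1 / 2) ^ α := by positivity
  have h3 : 0 ≤ 2 * a / (1 + a) := div_nonneg (by linarith) (by linarith)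
  have h4 : 2 * a / (1 + a) * (2 * (1 - a)) ^ α ≤ 2 * a / (1 + a) := mul_le_of_le_one_right h3 h2
  rw [sixPointValue_eq_mul_half_rpow h1.le] at hV
  nlinarith [h.two_mul_div_lt_one]

/-- Once the optimal six-point law is at least as good as the law of moment `2 ^ (-α)`, it is
strictly better for every larger exponent. -/
theorem IsOptimalParam.half_rpow_lt {α β a b : ℝ} (h : IsOptimalParam α a)
    (h' : IsOptimalParam β b) (hα : 0 < α) (hαβ : α < β)
    (hV : (1 / 2 : ℝ) ^ α ≤ sixPointValue α a) : (1 / 2 : ℝ) ^ β < sixPointValue β b := by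
  have ha := h.lt_half_of_half_rpow_le hα hV
  refine lt_of_lt_of_le ?_ (h'.sixPointValue_le (hα.trans hαβ) h.pos.le h.lt_one)
  rw [sixPointValue_eq_mul_half_rpow h.lt_one.le] at hV ⊢
  have h1 : (2 * (1 - a)) ^ α < (2 * (1 - a)) ^ β :=
    Real.rpow_lt_rpow_of_exponent_lt (by linarith) hαβ
  have h2 : 1 ≤ 2 * a / (1 + a) * (2 * (1 - a)) ^ α :=
    le_of_mul_le_mul_right (by rwa [one_mul]) (show (0 : ℝ) < (1 / 2) ^ α by positivity)
  have h3 : 0 < 2 * a / (1 + a) := div_pos (by linarith [h.pos]) (by linarith [h.pos])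
  exact lt_mul_of_one_lt_left (by positivity) (h2.trans_lt (mul_lt_mul_of_pos_left h1 h3))

/-- The numbers `12601 / 5202` and `1.4798` are `(1 + b) / (2 b)` and `2 (1 - b)` for `b = 0.2601`,
which approximates the optimal parameter at the critical exponent. -/
theorem log_ratio_mem : 0.884733 ≤ Real.log (12601 / 5202) ∧
    Real.log (12601 / 5202) ≤ 0.88473302 :=
  log_mem_Icc_of_artanh (x := 7399 / 17803) 11 (by norm_num) (by norm_num) (by norm_num)
    (by norm_num [Finset.sum_range_succ]) (by norm_num [Finset.sum_range_succ])

theorem log_base_mem : 0.39190694 ≤ Real.log 1.4798 ∧ Real.log 1.4798 ≤ 0.39190695 :=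
  log_mem_Icc_of_artanh (x := 2399 / 12399) 6 (by norm_num) (by norm_num) (by norm_num)
    (by norm_num [Finset.sum_range_succ]) (by norm_num [Finset.sum_range_succ])

theorem sixPointValue_eq_exp_mul (α : ℝ) : sixPointValue α 0.2601 =
    Real.exp (Real.log 1.4798 * α - Real.log (12601 / 5202)) * (1 / 2) ^ α := by
  rw [sixPointValue_eq_mul_half_rpow (by norm_num), Real.exp_sub, Real.exp_log (by norm_num),
    ← Real.rpow_def_of_pos (by norm_num), show (2 * (1 - 0.2601) : ℝ) = 1.4798 by norm_num]
  ring

theorem half_rpow_lt_sixPointValue_above {a : ℝ} (h : IsOptimalParam 2.257514 a) :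
    (1 / 2 : ℝ) ^ (2.257514 : ℝ) < sixPointValue 2.257514 a := by
  refine lt_of_lt_of_le ?_ (h.sixPointValue_le (by norm_num) (z := 0.2601) (by norm_num)
    (by norm_num))
  rw [sixPointValue_eq_exp_mul]
  refine lt_mul_of_one_lt_left (by positivity) (Real.one_lt_exp_iff.2 ?_)
  have h1 := log_ratio_mem.2
  have h2 := log_base_mem.1
  norm_num at h1 h2 ⊢
  linarith

theorem sixPointValue_lt_half_rpow_below {a : ℝ} (h : IsOptimalParam 2.2575055 a) :
    sixPointValue 2.2575055 a < (1 / 2 : ℝ) ^ (2.2575055 : ℝ) := by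
  have h0 := h.pos
  have h1 := h.lt_one
  refine lt_of_le_of_lt (sixPointValue_le_mul_exp (b := 0.2601) (by norm_num) (by norm_num)
    (by norm_num) h0 h1) ?_
  rw [sixPointValue_eq_exp_mul, mul_right_comm, ← Real.exp_add]
  refine mul_lt_of_lt_one_left (by positivity) (Real.exp_lt_one_iff.2 ?_)
  have hl1 := log_ratio_mem.1
  have hl2 := log_base_mem.2
  -- the exponent is concave in `a - 0.2601`, with a tiny slope at `0`
  have key : (a - 0.2601) * (1 / (0.2601 * (1 + a)) - 2.2575055 / (1 - 0.2601)) ≤ 1e-7 := by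
    set d := a - 0.2601 with hd
    have e : 1 / (0.2601 * (1 + a)) =
        1 / (0.2601 * 1.2601) - d * (1 / (0.2601 * 1.2601 * (1 + a))) := by
      rw [hd]; field_simp; ring
    have hk : 1 ≤ 1 / (0.2601 * 1.2601 * (1 + a)) := by
      rw [le_div_iff₀ (by positivity)]; norm_num; linarith
    rw [e]
    have h2 := mul_le_mul_of_nonneg_left hk (sq_nonneg d)
    have h3 : d * (1 / (0.2601 * 1.2601) - 2.2575055 / (1 - 0.2601)) ≤ d ^ 2 + 1e-7 := by
      norm_num
      nlinarith [sq_nonneg (d + 1 / 200000)]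
    linarith
  norm_num at hl1 hl2 key ⊢
  linarith

theorem continuousOn_largeValue : ContinuousOn largeValue (Set.Ioi 0) := by
  unfold largeValue
  have hs : Continuous fun α : ℝ => √(α ^ 2 + 6 * α + 1) := by fun_prop
  have hlow : ∀ α : ℝ, 0 < α → α + 1 < √(α ^ 2 + 6 * α + 1) := fun α hα =>
    Real.lt_sqrt_of_sq_lt (by nlinarith)
  have hup : ∀ α : ℝ, 0 < α → √(α ^ 2 + 6 * α + 1) < 3 * α + 1 := fun α hα => by
    rw [Real.sqrt_lt' (by linarith)]; nlinarith
  refine ContinuousOn.mul (continuousOn_const.mul (ContinuousOn.rpow ?_ continuousOn_id ?_)) ?_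
  · exact ContinuousOn.div (by fun_prop) (by fun_prop) fun α hα => by
      have := Set.mem_Ioi.1 hα; positivity
  · intro α hα
    have hα' := Set.mem_Ioi.1 hα
    exact Or.inl (div_pos (by linarith [hup α hα']) (by linarith)).ne'
  · exact ContinuousOn.div (by fun_prop) (by fun_prop) fun α hα => by
      have hα' := Set.mem_Ioi.1 hα
      have := hlow α hα'
      exact (by linarith : 0 < α - 1 + √(α ^ 2 + 6 * α + 1)).ne'

theorem half_rpow (α : ℝ) : (1 / 2 : ℝ) ^ α = 2 ^ (-α) := by
  rw [one_div, Real.inv_rpow (by norm_num), Real.rpow_neg (by norm_num)]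

theorem exists_largeValue_eq : ∃ α₀ ∈ Set.Ioo (2.2575055 : ℝ) 2.257514,
    largeValue α₀ = (1 / 2 : ℝ) ^ α₀ := by
  have hc : ContinuousOn (fun α => largeValue α - (1 / 2 : ℝ) ^ α)
      (Set.Icc (2.2575055 : ℝ) 2.257514) := by
    refine ContinuousOn.sub (continuousOn_largeValue.mono fun α hα => ?_) ?_
    · exact lt_of_lt_of_le (by norm_num) hα.1
    · exact (Real.continuous_const_rpow (by norm_num)).continuousOn
  have hlo := sixPointValue_lt_half_rpow_below (sixPointParam_isOptimalParam (by norm_num))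
  have hhi := half_rpow_lt_sixPointValue_above (sixPointParam_isOptimalParam (by norm_num))
  rw [← largeValue_eq_sixPointValue (by norm_num)] at hlo hhi
  obtain ⟨α₀, hα₀, h⟩ := intermediate_value_Ioo (by norm_num) hc
    (show (0 : ℝ) ∈ Set.Ioo _ _ from ⟨by linarith, by linarith⟩)
  exact ⟨α₀, hα₀, by simpa [sub_eq_zero] using h⟩

/-- The bound `2 ^ (-β)` passes to smaller exponents, by the pointwise Bernoulli inequality
`w ^ α ≤ 1 + α / β (w ^ β - 1)` for `w = 2 |x₁ - x₂|`. -/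
theorem IsCoherent.absDiffMoment_le_half_rpow_of_le {p α β : ℝ} {μ : Measure (ℝ × ℝ)}
    (hμ : IsCoherent.{u} p μ) (hα : 0 < α) (hαβ : α ≤ β)
    (h : absDiffMoment β μ ≤ (1 / 2 : ℝ) ^ β) : absDiffMoment α μ ≤ (1 / 2 : ℝ) ^ α := by
  have hβ : 0 < β := hα.trans_le hαβ
  have hprob : IsProbabilityMeasure μ := by
    obtain ⟨-, Ω, F₁, F₂, mΩ, P, X, hP, hF₁, hF₂, -, -, -, rfl⟩ := hμ
    exact Measure.isProbabilityMeasure_map (((stronglyMeasurable_condExp.mono hF₁).measurable.prodMk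
      (stronglyMeasurable_condExp.mono hF₂).measurable).aemeasurable)
  have hs : ∀ᵐ z ∂μ, z ∈ Set.Icc (0 : ℝ) 1 ×ˢ Set.Icc (0 : ℝ) 1 := hμ.1
  have hint : ∀ γ : ℝ, 0 < γ → Integrable (fun z : ℝ × ℝ => |z.1 - z.2| ^ γ) μ := by
    intro γ hγ
    have hcont : Continuous fun x : ℝ × ℝ => |x.1 - x.2| ^ γ :=
      (continuous_fst.sub continuous_snd).abs.rpow_const fun _ => Or.inr hγ.le
    refine Integrable.of_bound hcont.aestronglyMeasurable 1 ?_
    filter_upwards [hs] with z hz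
    have h : |z.1 - z.2| ≤ 1 := by
      rw [abs_le]; constructor <;> linarith [hz.1.1, hz.1.2, hz.2.1, hz.2.2]
    rw [Real.norm_of_nonneg (by positivity)]
    exact Real.rpow_le_one (abs_nonneg _) h hγ.le
  have hpt : ∀ z : ℝ × ℝ, |z.1 - z.2| ^ α ≤
      (1 / 2) ^ α * (1 - α / β) + (1 / 2) ^ α * (α / β) * 2 ^ β * |z.1 - z.2| ^ β := by
    intro z
    have hw : 0 ≤ (2 * |z.1 - z.2|) ^ β := by positivity
    have h1 := rpow_one_add_le_one_add_mul_self
      (s := (2 * |z.1 - z.2|) ^ β - 1) (p := α / β) (by linarith) (by positivity)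
      ((div_le_one hβ).2 hαβ)
    rw [add_sub_cancel, ← Real.rpow_mul (by positivity), mul_div_cancel₀ _ hβ.ne',
      Real.mul_rpow (by norm_num) (abs_nonneg _), Real.mul_rpow (by norm_num) (abs_nonneg _)] at h1
    have h2 : (1 / 2 : ℝ) ^ α * 2 ^ α = 1 := by
      rw [← Real.mul_rpow (by norm_num) (by norm_num)]; norm_num
    have h3 := mul_le_mul_of_nonneg_left h1 (show (0 : ℝ) ≤ (1 / 2) ^ α by positivity)
    rw [← mul_assoc, h2, one_mul] at h3
    linarith
  have h2 : (2 : ℝ) ^ β * (1 / 2) ^ β = 1 := by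
    rw [← Real.mul_rpow (by norm_num) (by norm_num)]; norm_num
  calc absDiffMoment α μ
      ≤ ∫ z, (1 / 2) ^ α * (1 - α / β) + (1 / 2) ^ α * (α / β) * 2 ^ β * |z.1 - z.2| ^ β ∂μ :=
        integral_mono (hint α hα) ((integrable_const _).add ((hint β hβ).const_mul _)) hpt
    _ = (1 / 2) ^ α * (1 - α / β) + (1 / 2) ^ α * (α / β) * 2 ^ β * absDiffMoment β μ := by
        rw [integral_add (integrable_const _) ((hint β hβ).const_mul _)]
        simp only [integral_const, integral_const_mul, probReal_univ, one_smul, absDiffMoment]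
    _ ≤ (1 / 2) ^ α * (1 - α / β) + (1 / 2) ^ α * (α / β) * 2 ^ β * (1 / 2) ^ β := by gcongr
    _ = (1 / 2) ^ α := by rw [mul_assoc _ (2 ^ β) _, h2]; ring

theorem IsCoherent.absDiffMoment_le_largeValue {α : ℝ} {μ : Measure (ℝ × ℝ)}
    (hμ : IsCoherent.{u} (1 / 2) μ) (hα : 9 / 4 ≤ α) (hV : (1 / 2 : ℝ) ^ α ≤ largeValue α) :
    absDiffMoment α μ ≤ largeValue α := by
  have hα0 : 0 < α := by linarith
  have h := sixPointParam_isOptimalParam hα0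
  rw [largeValue_eq_sixPointValue hα0] at hV ⊢
  rcases le_total α 4 with h4 | h4
  · refine hμ.absDiffMoment_le_of_le_four hα h4 ?_ hV fun z hz hz1 => h.sixPointValue_le hα0 hz hz1
    have h1 := h.lt_one
    have h0 := h.pos
    exact mul_le_one₀ h.two_mul_div_lt_one.le (Real.rpow_nonneg (by linarith) _)
      (Real.rpow_le_one (by linarith) (by linarith) hα0.le)
  · exact hμ.absDiffMoment_le_of_four_le h4 h

theorem theorem1p3 :
    ∃ α₀ : ℝ, |α₀ - 2.25751| < 0.000005 ∧
      (∀ α : ℝ, 0 < α → (largeValue α = (2 : ℝ) ^ (-α) ↔ α = α₀)) ∧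
      ∀ α : ℝ, 0 < α →
        (α < α₀ →
          IsGreatest (absDiffMoment α '' {μ | IsCoherent.{u} (1 / 2) μ}) ((2 : ℝ) ^ (-α))) ∧
        (α₀ ≤ α →
          IsGreatest (absDiffMoment α '' {μ | IsCoherent.{u} (1 / 2) μ}) (largeValue α) ∧
          0 < sixPointParam α ∧ sixPointParam α < 1 / 2 ∧
          IsCoherent.{u} (1 / 2) (sixPoint (sixPointParam α)) ∧
          absDiffMoment α (sixPoint (sixPointParam α)) = largeValue α) := by
  obtain ⟨α₀, ⟨hlo, hhi⟩, h₀⟩ := exists_largeValue_eq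
  norm_num at hlo hhi
  have hα₀ : 0 < α₀ := by linarith
  have hmono : ∀ α β : ℝ, 0 < α → α < β → (1 / 2 : ℝ) ^ α ≤ largeValue α →
      (1 / 2 : ℝ) ^ β < largeValue β := by
    intro α β hα hαβ hV
    rw [largeValue_eq_sixPointValue hα] at hV
    rw [largeValue_eq_sixPointValue (hα.trans hαβ)]
    exact (sixPointParam_isOptimalParam hα).half_rpow_lt
      (sixPointParam_isOptimalParam (hα.trans hαβ)) hα hαβ hV
  refine ⟨α₀, ?_, ?_, ?_⟩
  · rw [abs_lt]; norm_num; constructor <;> linarith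
  · intro α hα
    rw [← half_rpow]
    refine ⟨fun h => ?_, fun h => h ▸ h₀⟩
    rcases lt_trichotomy α α₀ with hlt | heq | hgt
    · exact absurd h₀ (hmono α α₀ hα hlt h.ge).ne'
    · exact heq
    · exact absurd h (hmono α₀ α hα₀ hgt h₀.ge).ne'
  · intro α hα
    refine ⟨fun hlt => ⟨?_, ?_⟩, fun hge => ?_⟩
    · obtain ⟨μ, hμ, h⟩ := exists_isCoherent_absDiffMoment_eq_two_rpow_neg.{u} α
      exact ⟨μ, hμ, h⟩
    · rintro _ ⟨μ, hμ, rfl⟩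
      rw [← half_rpow]
      refine hμ.absDiffMoment_le_half_rpow_of_le hα hlt.le ?_
      rw [← h₀]
      exact hμ.absDiffMoment_le_largeValue (by linarith) h₀.ge
    · have hV : (1 / 2 : ℝ) ^ α ≤ largeValue α := by
        rcases hge.eq_or_lt with rfl | hlt
        · exact h₀.ge
        · exact (hmono α₀ α hα₀ hlt h₀.ge).le
      have h := sixPointParam_isOptimalParam hα
      have hhalf : sixPointParam α < 1 / 2 :=
        h.lt_half_of_half_rpow_le hα (by rwa [← largeValue_eq_sixPointValue hα])
      have hcoh := isCoherent_sixPoint.{u} h.pos hhalf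
      have hval : absDiffMoment α (sixPoint (sixPointParam α)) = largeValue α := by
        rw [absDiffMoment_sixPoint hα h.pos hhalf, largeValue_eq_sixPointValue hα, sixPointValue]
      refine ⟨⟨⟨_, hcoh, hval⟩, ?_⟩, h.pos, hhalf, hcoh, hval⟩
      rintro _ ⟨μ, hμ, rfl⟩
      exact hμ.absDiffMoment_le_largeValue (by linarith) hV
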